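/- Let $s=xy+1$, $p=xs+1$, $u=s^2+y$ and $$g=p^2u-\tfrac53\,ps-\tfrac13\,s\in\mathbb{C}[x,y],$$ a polynomial of degree $10$. For $t\in\mathbb{C}$ let $C_t\subset\mathbb{P}^2$ be the projective closure of the affine curve $g^{-1}(t)\subset\mathbb{C}^2$, i.e. the curve $f_t=0$, where $f_t\in S=\mathbb{C}[x,y,z]$ is the homogenization of $g-t$. Put $b=-\frac{16}{9}$. For a reduced curve $C:f=0$ of degree $d$ in $\mathbb{P}^2$, let $D_0(f)=\{(\alpha,\beta,\gamma)\in S^3:\alpha f_x+\beta f_y+\gamma f_z=0\}$. We say that $C$ is an $m$-syzygy curve with exponents $(d_1,\dots,d_m)$, $d_1\le\dots\le d_m$, if the $S$-module $D_0(f)$ is minimally generated by $m$ homogeneous elements of degrees $d_1,\dots,d_m$. The curve $C$ is free if it is a $2$-syzygy curve. It is a minimal plus-one generated (MPOG) curve if it is a $3$-syzygy curve with $d_1+d_2=d$ and $d_3=d_2+1$. The total Tjurina number $\tau(C)$ is the degree of the Jacobian ideal $J_f=(f_x,f_y,f_z)$, that is $\tau(C)=\dim_{\mathbb{C}}(S/J_f)_k$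 for all sufficiently large $k$. Then $C_0$, $C_1$ and $C_b$ are reduced and irreducible curves of degree $10$, their geometric genera are $$g(C_1)=1\quad\text{and}\quad g(C_0)=g(C_b)=0,$$ and the following hold. 1. $C_0$ and $C_1$ are MPOG curves with exponents $(5,5,6)$, and $\tau(C_0)=\tau(C_1)=59$. 2. $C_b$ is a free curve with exponents $(4,5)$, and $\tau(C_b)=61$. -/

import Mathlib

open MvPolynomial
open scoped KaehlerDifferential

noncomputable section

namespace PlaneCurve

/-! Plane projective curves over `ℂ` are given by polynomials in `ℂ[x, y, z]`,
with `x = X 0`, `y = X 1`, `z = X 2`. -/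

/-- The polynomial ring `S = ℂ[x, y, z]`. -/
abbrev S : Type := MvPolynomial (Fin 3) ℂ

/-- `f = 0` is a reduced curve of degree `d` in the complex projective plane. -/
structure IsReducedCurve (f : S) (d : ℕ) : Prop where
  homogeneous : f.IsHomogeneous d
  degree_pos : 0 < d
  reduced : Squarefree f

/-! ### Jacobian syzygies and exponents -/

/-- The module `D₀(f)` of triples `(a, b, c)` with `a f_x + b f_y + c f_z = 0`. -/
def jacobianSyzygies (f : S) : Submodule S (Fin 3 → S) where
  carrier := {ρ | ∑ i, ρ i * pderiv i f = 0}
  zero_mem' := by simp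
  add_mem' := by
    intro a b ha hb
    simp only [Set.mem_ofPred_eq, Pi.add_apply, add_mul, Finset.sum_add_distrib] at *
    rw [ha, hb, add_zero]
  smul_mem' := by
    intro c a ha
    simp only [Set.mem_ofPred_eq, Pi.smul_apply, smul_eq_mul, mul_assoc] at *
    rw [← Finset.mul_sum, ha, mul_zero]

/-- `f = 0` is an `m`-syzygy curve with exponents `d₁ ≤ … ≤ dₘ`: the module `D₀(f)` is minimally
generated by `m` homogeneous syzygies of degrees `d₁, …, dₘ`. Minimality is expressed by requiring
that no generator lies in the submodule generated by the other ones. -/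
def HasExponents (f : S) {m : ℕ} (d : Fin m → ℕ) : Prop :=
  Monotone d ∧ ∃ ρ : Fin m → (Fin 3 → S),
    (∀ j i, (ρ j i).IsHomogeneous (d j)) ∧
    Submodule.span S (Set.range ρ) = jacobianSyzygies f ∧
    ∀ j, ρ j ∉ Submodule.span S (ρ '' {j}ᶜ)

/-- A free curve is a `2`-syzygy curve; here with exponents `(d₁, d₂)`. -/
def IsFreeWithExponents (f : S) (d₁ d₂ : ℕ) : Prop :=
  HasExponents f ![d₁, d₂]

/-- A plus-one generated curve with exponents `(d₁, d₂, d₃)`: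
a `3`-syzygy curve such that `d₁ + d₂` is the degree of the curve. -/
def IsPlusOneGeneratedWithExponents (f : S) (d₁ d₂ d₃ : ℕ) : Prop :=
  HasExponents f ![d₁, d₂, d₃] ∧ d₁ + d₂ = f.totalDegree

/-- A minimal plus-one generated (MPOG) curve with exponents `(d₁, d₂, d₃)`:
a plus-one generated curve such that `d₃ - d₂ = 1`. -/
def IsMPOGWithExponents (f : S) (d₁ d₂ d₃ : ℕ) : Prop :=
  IsPlusOneGeneratedWithExponents f d₁ d₂ d₃ ∧ d₃ = d₂ + 1

/-! ### The total Tjurina number -/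

/-- The Jacobian ideal `J_f = (f_x, f_y, f_z)`. -/
def jacobianIdeal (f : S) : Ideal S :=
  Ideal.span (Set.range fun i : Fin 3 => pderiv i f)

/-- The degree `k` component of the graded Milnor algebra `M(f) = S / J_f`
(for homogeneous `f`): the image of the space of forms of degree `k`. -/
def milnorComponent (f : S) (k : ℕ) : Submodule ℂ (S ⧸ jacobianIdeal f) :=
  (homogeneousSubmodule (Fin 3) ℂ k).map
    (Ideal.Quotient.mkₐ ℂ (jacobianIdeal f)).toLinearMap

/-- The total Tjurina number of the reduced curve `f = 0` is `τ`. It is the degree of the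
Jacobian ideal, that is the degree of the zero-dimensional projective scheme defined by `J_f`,
which is the constant value of the Hilbert polynomial of `M(f)`. -/
def HasTotalTjurinaNumber (f : S) (τ : ℕ) : Prop :=
  ∀ᶠ k in Filter.atTop, Module.finrank ℂ (milnorComponent f k) = τ

/-! ### The geometric genus -/

/-- For a field `K` over `ℂ`, the everywhere regular differentials: the `ω ∈ Ω[K⁄ℂ]` that,
for every valuation ring `O` of `K` containing `ℂ`, are of the form `∑ aᵢ d bᵢ` with
`aᵢ, bᵢ ∈ O`. If `K` is the function field of a curve, the valuation rings `O ≠ K` are the local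
rings of the points of its smooth projective model `X`, so that this is `H⁰(X, Ω¹)`. -/
def regularDifferentials (K : Type) [Field K] [Algebra ℂ K] : Submodule ℂ (Ω[K⁄ℂ]) :=
  ⨅ (O : ValuationSubring K) (_ : ∀ c : ℂ, algebraMap ℂ K c ∈ O),
    Submodule.span ℂ {ω | ∃ a ∈ O, ∃ b ∈ O, ω = a • KaehlerDifferential.D ℂ K b}

/-- The homogeneous coordinate ring `S / (f)`. -/
abbrev CoordRing (f : S) : Type := S ⧸ Ideal.span {f}

lemma coordRing_isDomain {f : S} (hf : Irreducible f) : IsDomain (CoordRing f) :=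
  (Ideal.Quotient.isDomain_iff_prime _).2
    ((Ideal.span_singleton_prime hf.ne_zero).2 hf.prime)

/-- The fraction field of the homogeneous coordinate ring. -/
abbrev ConeField (f : S) : Type := FractionRing (CoordRing f)

instance {f : S} [Fact (Irreducible f)] : IsDomain (CoordRing f) :=
  coordRing_isDomain Fact.out

/-- The function field of the irreducible curve `f = 0` (`f` homogeneous): the subfield of
`Frac (S / (f))` of the quotients of forms of the same degree. -/
def functionField (f : S) [Fact (Irreducible f)] : IntermediateField ℂ (ConeField f) :=
  IntermediateField.adjoin ℂ {q | ∃ (k : ℕ) (a b : S), a.IsHomogeneous k ∧ b.IsHomogeneous k ∧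
    q = algebraMap (CoordRing f) (ConeField f) (Ideal.Quotient.mk _ a) /
      algebraMap (CoordRing f) (ConeField f) (Ideal.Quotient.mk _ b)}

/-- The geometric genus of the irreducible curve `f = 0`, that is the genus of its smooth
projective model: the dimension of the space of regular differentials of its function field. -/
def geometricGenus (f : S) [Fact (Irreducible f)] : Cardinal :=
  Module.rank ℂ (regularDifferentials (functionField f))

/-- The curve `f = 0` is irreducible, of geometric genus `n`. -/
def HasGeometricGenus (f : S) (n : ℕ) : Prop :=
  ∃ _ : Fact (Irreducible f), geometricGenus f = n

/-! ### Projective closures of affine plane curves -/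

/-- The homogenization in degree `d` of a polynomial of degree at most `d`:
`x ^ i * y ^ j` becomes `x ^ i * y ^ j * z ^ (d - i - j)`. -/
def homogenizeTo (d : ℕ) (h : MvPolynomial (Fin 2) ℂ) : S :=
  ∑ m ∈ h.support, C (h.coeff m) * X 0 ^ m 0 * X 1 ^ m 1 * X 2 ^ (d - (m 0 + m 1))

/-- The equation of the closure in the projective plane of the affine curve `h = 0`: the
homogenization of `h`. The affine plane is the part `z ≠ 0`, with coordinates `x / z`, `y / z`. -/
def projectiveClosure (h : MvPolynomial (Fin 2) ℂ) : S :=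
  homogenizeTo h.totalDegree h

end PlaneCurve

namespace Briancon

open PlaneCurve

/-- `s = x y + 1`. -/
def s : MvPolynomial (Fin 2) ℂ := X 0 * X 1 + 1

/-- `p = x s + 1`. -/
def p : MvPolynomial (Fin 2) ℂ := X 0 * s + 1

/-- `u = s ^ 2 + y`. -/
def u : MvPolynomial (Fin 2) ℂ := s ^ 2 + X 1

/-- The polynomial `g = p² u - (5/3) p s - (1/3) s`. -/
def g : MvPolynomial (Fin 2) ℂ :=
  p ^ 2 * u - C (5 / 3) * p * s - C (1 / 3) * s

/-- The equation of the curve `C_t`, the projective closure of the affine curve `g = t`. -/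
def curve (t : ℂ) : S := projectiveClosure (g - C t)

end Briancon

end

/-! Genus. On the curve, `s` and `p` satisfy 3p³s² - (8p² - 4p - 1)s - 3t(p - 1) = 0, and x = (p -
1)/s, so the function field is ℂ(p, s). Completing the square gives ℂ(p, w) with w² = (64 + 36t)(p⁴
- p³) + 8p + 1. For t = 0 the relation is divisible by s and the field is ℂ(p); for t = -16/9 it is
ℂ(w), as w² = 8p + 1; for t = 1 the quartic is squarefree and dp/w spans the regular differentials.
These are computed from two charts, x and 1/x:
`exists_algebraMap_eq_of_smul_mem_regularDifferentials` makes the coefficient of a regular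
differential integral in each chart, and comparing the charts gives `regularDifferentials_eq_bot`
and `regularDifferentials_eq_span`.

Irreducibility. Up to the factor x², the equation is a monic quartic in p. At x = 0 it becomes p³(p
- 1), and its constant term vanishes there only to first order. Hence one of two factors is nonzero
at the origin and has degree at most one; it is trivial because the quartic has no polynomial root.

Syzygies. Explicit syzygies r₁, r₂ have r₁ × r₂ equal to a multiple of the gradient. A nonzero
constant multiple gives freeness (Saito's criterion). If the multiple is a linear form l, one needs
a third syzygy with h₁r₁ + h₂r₂ + l r₃ = 0 and h₁, h₂ coprime on the line l = 0; then the three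
generate minimally and have this single relation (`hasExponents_of_cross_eq`). The resulting graded
free resolution of the Milnor algebra gives its Hilbert polynomial, hence τ. -/

namespace PlaneCurve

/-! ### Regular differentials and étale coordinates -/

open KaehlerDifferential in
/-- A regular differential has coefficients in every Dedekind ring `R` of the function field
whose differentials are multiples of `ω₀`. -/
theorem exists_algebraMap_eq_of_smul_mem_regularDifferentials {K : Type} [Field K] [Algebra ℂ K]
    (R : Type) [CommRing R] [IsDedekindDomain R] [Algebra ℂ R] [Algebra R K] [IsScalarTower ℂ R K]
    [IsFractionRing R K] {ω₀ : Ω[K⁄ℂ]} (hω₀ : ω₀ ≠ 0)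
    (hD : ∀ b : R, ∃ c : R, D ℂ K (algebraMap R K b) = algebraMap R K c • ω₀) {h : K}
    (hh : h • ω₀ ∈ regularDifferentials K) : ∃ c : R, algebraMap R K c = h := by
  -- An element of the fraction field lies in `R` once it is integral at every height one prime, so
  -- the valuation ring of each `v` is tested separately.
  refine IsDedekindDomain.HeightOneSpectrum.mem_integers_of_valuation_le_one (R := R) K h ?_
  intro v
  set O : ValuationSubring K := (v.valuation K).valuationSubring with hO
  have hRO : ∀ r : R, algebraMap R K r ∈ O := fun r => v.valuation_le_one r
  have hmem := hh
  simp only [regularDifferentials, Submodule.mem_iInf] at hmem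
  have h1 := hmem O (fun c => by rw [IsScalarTower.algebraMap_apply ℂ R K]; exact hRO _)
  have key : ∀ ω ∈ Submodule.span ℂ {ω : Ω[K⁄ℂ] | ∃ a ∈ O, ∃ b ∈ O, ω = a • D ℂ K b},
      ∃ c ∈ O, ω = c • ω₀ := by
    intro ω hω
    induction hω using Submodule.span_induction with
    | zero => exact ⟨0, O.zero_mem, by simp⟩
    | add x y _ _ hx hy =>
      obtain ⟨c, hc, rfl⟩ := hx
      obtain ⟨d, hd, rfl⟩ := hy
      exact ⟨c + d, O.add_mem _ _ hc hd, (add_smul _ _ _).symm⟩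
    | smul a x _ hx =>
      obtain ⟨c, hc, rfl⟩ := hx
      refine ⟨algebraMap ℂ K a * c, O.mul_mem _ _ ?_ hc, ?_⟩
      · rw [IsScalarTower.algebraMap_apply ℂ R K]; exact hRO _
      · rw [mul_smul, algebraMap_smul]
    | mem x hx =>
      obtain ⟨a, ha, b, hb, rfl⟩ := hx
      -- Write b = n/d with d a unit at `v`; the quotient rule db = d⁻¹(dn - b dd) shows that db is
      -- an `O`-multiple of `ω₀`.
      obtain ⟨n, d, hnd⟩ := v.exists_primeCompl_mul_eq_of_integer (K := K) b hb
      obtain ⟨c₁, hc₁⟩ := hD n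
      obtain ⟨c₂, hc₂⟩ := hD d
      have hd1 : v.valuation K (algebraMap R K d) = 1 := by
        rw [v.valuation_of_algebraMap]
        exact (v.intValuation_eq_one_iff_mem_primeCompl _).2 d.2
      have hd0 : algebraMap R K d ≠ 0 := by
        intro h0
        rw [h0, map_zero] at hd1
        exact zero_ne_one hd1
      have hdi : (algebraMap R K d)⁻¹ ∈ O := by
        change v.valuation K _ ≤ 1
        rw [map_inv₀, hd1, inv_one]
      refine ⟨a * ((algebraMap R K d)⁻¹ * (algebraMap R K c₁ - b * algebraMap R K c₂)),
        O.mul_mem _ _ ha (O.mul_mem _ _ hdi (sub_mem (hRO _) (O.mul_mem _ _ hb (hRO _)))), ?_⟩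
      have h2 := congrArg (D ℂ K) hnd
      rw [Derivation.leibniz, hc₁, hc₂] at h2
      rw [mul_smul]
      congr 1
      rw [mul_smul, sub_smul, ← h2, mul_smul, add_sub_cancel_left, smul_smul,
        inv_mul_cancel₀ hd0, one_smul]
  obtain ⟨c, hc, hceq⟩ := key _ h1
  rwa [smul_left_injective K hω₀ hceq]

section Etale

open Polynomial in
-- In characteristic zero `K` is separable over ℂ(X), and ℂ(X) is a localization of ℂ[X]; both steps
-- are formally étale.
theorem formallyEtale_of_isAlgebraic_polynomial (K : Type) [Field K] [Algebra ℂ[X] K]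
    [FaithfulSMul ℂ[X] K] [Algebra.IsAlgebraic ℂ[X] K] : Algebra.FormallyEtale ℂ[X] K := by
  let : Algebra (FractionRing ℂ[X]) K := FractionRing.liftAlgebra ℂ[X] K
  have : IsScalarTower ℂ[X] (FractionRing ℂ[X]) K := FractionRing.isScalarTower_liftAlgebra _ _
  have : Algebra.IsAlgebraic (FractionRing ℂ[X]) K :=
    (IsFractionRing.comap_isAlgebraic_iff (A := ℂ[X])).1 inferInstance
  have : Algebra.FormallyEtale (FractionRing ℂ[X]) K := Algebra.FormallyEtale.of_isSeparable _ _
  have : Algebra.FormallyEtale ℂ[X] (FractionRing ℂ[X]) :=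
    Algebra.FormallyEtale.of_isLocalization (nonZeroDivisors ℂ[X])
  exact Algebra.FormallyEtale.comp ℂ[X] (FractionRing ℂ[X]) K

variable (K : Type) [Field K] [Algebra ℂ K] [Algebra (Polynomial ℂ) K]
  [IsScalarTower ℂ (Polynomial ℂ) K] [Algebra.FormallyEtale (Polynomial ℂ) K]

open Polynomial KaehlerDifferential TensorProduct in
-- Étale base change identifies `Ω[K⁄ℂ]` with K ⊗ Ω[ℂ[X]⁄ℂ], which is free on dX.
theorem exists_linearEquiv_kaehler : ∃ e : Ω[K⁄ℂ] ≃ₗ[K] K,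
    e (D ℂ K (algebraMap ℂ[X] K Polynomial.X)) = 1 := by
  let e₁ := (tensorKaehlerEquivOfFormallyEtale ℂ ℂ[X] K).symm
  let e₂ : K ⊗[ℂ[X]] Ω[ℂ[X]⁄ℂ] ≃ₗ[K] K ⊗[ℂ[X]] ℂ[X] :=
    (polynomialEquiv ℂ).baseChange ℂ[X] K _ _
  let e₃ : K ⊗[ℂ[X]] ℂ[X] ≃ₗ[K] K := AlgebraTensorModule.rid ℂ[X] K K
  refine ⟨e₁ ≪≫ₗ e₂ ≪≫ₗ e₃, ?_⟩
  simp only [LinearEquiv.trans_apply, e₁, tensorKaehlerEquivOfFormallyEtale_symm_D_algebraMap]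
  simp [e₂, e₃]

end Etale

end PlaneCurve

/-! ### Integral elements of a quadratic extension of ℂ(x) -/

namespace PlaneCurve

section QuadraticExtension

open Polynomial

variable {k K : Type} [Field k] [Field K] [Algebra k K]

theorem exists_eq_add_mul_of_adjoin_eq_top {y : K} {c : k} (hy : y ^ 2 = algebraMap k K c)
    (hK : IntermediateField.adjoin k {y} = ⊤) (h : K) :
    ∃ a b : k, h = algebraMap k K a + algebraMap k K b * y := by
  have hint : IsIntegral k y := .of_pow two_pos (by rw [hy]; exact isIntegral_algebraMap)
  have hmem : h ∈ Algebra.adjoin k {y} := by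
    rw [← IntermediateField.adjoin_simple_toSubalgebra_of_isAlgebraic hint.isAlgebraic, hK]
    trivial
  induction hmem using Algebra.adjoin_induction with
  | mem x hx => exact ⟨0, 1, by simpa using hx⟩
  | algebraMap r => exact ⟨r, 0, by simp⟩
  | add x z _ _ hx hz =>
    obtain ⟨a, b, rfl⟩ := hx
    obtain ⟨a', b', rfl⟩ := hz
    exact ⟨a + a', b + b', by simp only [map_add]; ring⟩
  | mul x z _ _ hx hz =>
    obtain ⟨a, b, rfl⟩ := hx
    obtain ⟨a', b', rfl⟩ := hz
    refine ⟨a * a' + b * b' * c, a * b' + b * a', ?_⟩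
    simp only [map_add, map_mul, ← hy]
    ring

variable [Algebra ℂ[X] k] [IsFractionRing ℂ[X] k] [Algebra ℂ[X] K] [IsScalarTower ℂ[X] k K]
  {F : ℂ[X]} (hF : Squarefree F)
include hF

/-- Since (bF)² = cF, the element bF is integral, hence a polynomial e with F ∣ e². Squarefreeness
gives F ∣ e, so b has no denominator. -/
theorem exists_algebraMap_eq_of_sq_mul {b : k} {c : ℂ[X]}
    (h : b ^ 2 * algebraMap ℂ[X] k F = algebraMap ℂ[X] k c) : ∃ e, algebraMap ℂ[X] k e = b := by
  have hF0 : algebraMap ℂ[X] k F ≠ 0 := by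
    rw [Ne, FaithfulSMul.algebraMap_eq_zero_iff]; exact hF.ne_zero
  have hsq : (b * algebraMap ℂ[X] k F) ^ 2 = algebraMap ℂ[X] k (c * F) := by
    rw [map_mul, ← h]; ring
  obtain ⟨e, he⟩ := IsIntegrallyClosed.algebraMap_eq_of_integral
    (IsIntegral.of_pow two_pos (by rw [hsq]; exact isIntegral_algebraMap) :
      IsIntegral ℂ[X] (b * algebraMap ℂ[X] k F))
  have hdvd : F ∣ e ^ 2 := by
    refine ⟨c, FaithfulSMul.algebraMap_injective ℂ[X] k ?_⟩
    rw [map_pow, he, hsq, mul_comm]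
  obtain ⟨e', rfl⟩ := (hF.dvd_pow_iff_dvd two_ne_zero).1 hdvd
  refine ⟨e', mul_right_cancel₀ hF0 ?_⟩
  rw [← he, map_mul, mul_comm]

/-- A square root of `F` in ℂ(x) would be a polynomial, and a squarefree square is a unit, against
the degree. -/
theorem notMem_range_of_sq_eq (hdeg : F.natDegree ≠ 0) {y : K}
    (hy : y ^ 2 = algebraMap ℂ[X] K F) : y ∉ (algebraMap k K).range := by
  rintro ⟨b, rfl⟩
  have hb : b ^ 2 = algebraMap ℂ[X] k F := by
    apply (algebraMap k K).injective
    rw [map_pow, hy, ← IsScalarTower.algebraMap_apply]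
  obtain ⟨e, he⟩ := IsIntegrallyClosed.algebraMap_eq_of_integral
    (IsIntegral.of_pow two_pos (by rw [hb]; exact isIntegral_algebraMap) : IsIntegral ℂ[X] b)
  have hFe : F = e * e := by
    apply FaithfulSMul.algebraMap_injective ℂ[X] k
    rw [← hb, map_mul, he, pow_two]
  have hu : IsUnit e := hF e ⟨1, by rw [mul_one, ← hFe]⟩
  apply hdeg
  rw [hFe]
  exact Polynomial.natDegree_eq_zero_of_isUnit (hu.mul hu)

/-- The integral closure of `ℂ[x]` in `ℂ(x, y)`, `y ^ 2 = F(x)`, is `ℂ[x] + ℂ[x] y`. -/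
theorem exists_eq_add_mul_of_isIntegral (hdeg : F.natDegree ≠ 0) {y : K}
    (hy : y ^ 2 = algebraMap ℂ[X] K F) (hK : IntermediateField.adjoin k {y} = ⊤) {h : K}
    (hh : IsIntegral ℂ[X] h) :
    ∃ P Q : ℂ[X], h = algebraMap ℂ[X] K P + algebraMap ℂ[X] K Q * y := by
  have hy' : y ^ 2 = algebraMap k K (algebraMap ℂ[X] k F) := by
    rw [hy, ← IsScalarTower.algebraMap_apply]
  obtain ⟨a, b, rfl⟩ := exists_eq_add_mul_of_adjoin_eq_top hy' hK h
  by_cases hb : b = 0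
  · subst hb
    have : IsIntegral ℂ[X] a := by
      rw [map_zero, zero_mul, add_zero] at hh
      exact (isIntegral_algebraMap_iff (algebraMap k K).injective).1 hh
    obtain ⟨e, rfl⟩ := IsIntegrallyClosed.algebraMap_eq_of_integral this
    exact ⟨e, 0, by simp [← IsScalarTower.algebraMap_apply]⟩
  · set h := algebraMap k K a + algebraMap k K b * y with hdef
    have hhk : IsIntegral k h := hh.tower_top
    have hnot : h ∉ (algebraMap k K).range := by
      rintro ⟨c, hc⟩
      apply notMem_range_of_sq_eq (k := k) hF hdeg hy
      refine ⟨(c - a) / b, ?_⟩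
      rw [map_div₀, map_sub, hc, hdef, add_sub_cancel_left,
        mul_div_cancel_left₀ _ (by simpa using hb)]
    obtain ⟨d, hd⟩ : ∃ d, d = a ^ 2 - b ^ 2 * algebraMap ℂ[X] k F := ⟨_, rfl⟩
    -- The minimal polynomial of h = a + by over k, with trace 2a and norm d = a² - b²F.
    let q : k[X] := Polynomial.X ^ 2 + (Polynomial.C (-2 * a) * Polynomial.X + Polynomial.C d)
    have hqd : (Polynomial.C (-2 * a) * Polynomial.X + Polynomial.C d).degree <
        ((2 : ℕ) : WithBot ℕ) := lt_of_le_of_lt degree_linear_le (by norm_num)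
    have hqm : q.Monic := monic_X_pow_add hqd
    have hq2 : q.natDegree = 2 := by
      rw [natDegree_eq_of_degree_eq_some]
      exact (degree_add_eq_left_of_degree_lt (by rwa [degree_X_pow])).trans (degree_X_pow _)
    have hqe : Polynomial.aeval h q = 0 := by
      simp only [q, map_add, map_mul, map_pow, Polynomial.aeval_X, Polynomial.aeval_C, map_sub, map_neg, map_ofNat,
        hd, map_sub, map_mul, map_pow, ← hy', hdef]
      ring
    have hmin : q = minpoly k h :=
      eq_of_monic_of_dvd_of_natDegree_le (minpoly.monic hhk) hqm (minpoly.dvd _ _ hqe)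
        (by rw [hq2]; exact (minpoly.two_le_natDegree_iff hhk).2 hnot)
    -- As h is integral over the integrally closed ring ℂ[X], trace and norm are polynomials. So a
    -- is a polynomial, then b²F is, and then b is.
    rw [minpoly.isIntegrallyClosed_eq_field_fractions' k hh] at hmin
    have h1 := congrArg (fun r => r.coeff 1) hmin
    have h0 := congrArg (fun r => r.coeff 0) hmin
    simp [q, Polynomial.coeff_X, Polynomial.coeff_C] at h1 h0
    set m1 := (minpoly ℂ[X] h).coeff 1
    set m0 := (minpoly ℂ[X] h).coeff 0
    have ha : a = algebraMap ℂ[X] k (Polynomial.C (-1 / 2) * m1) := by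
      have h2 : algebraMap ℂ[X] k (Polynomial.C (-1 / 2)) * (-2) = 1 := by
        rw [← map_one (algebraMap ℂ[X] k), ← map_ofNat (algebraMap ℂ[X] k) 2, ← map_neg,
          ← map_mul]
        congr 1
        rw [← Polynomial.C_ofNat, ← Polynomial.C_neg, ← Polynomial.C_mul]
        norm_num
      rw [map_mul, ← h1]
      linear_combination (-a) * h2
    obtain ⟨e, rfl⟩ := exists_algebraMap_eq_of_sq_mul (k := k) hF (b := b)
      (c := (Polynomial.C (-1 / 2) * m1) ^ 2 - m0) (by
        rw [map_sub, map_pow, ← ha]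
        linear_combination hd - h0)
    refine ⟨Polynomial.C (-1 / 2) * m1, e, ?_⟩
    rw [hdef, IsScalarTower.algebraMap_apply ℂ[X] k K, ← ha,
      IsScalarTower.algebraMap_apply ℂ[X] k K]

end QuadraticExtension

end PlaneCurve

/-! ### Affine charts: the line and the double cover y² = F(x) -/

namespace PlaneCurve

section Charts

open Polynomial

variable {K : Type} [Field K] [Algebra ℂ K]

theorem smul_D_generates [Algebra ℂ[X] K] [IsScalarTower ℂ ℂ[X] K] [FaithfulSMul ℂ[X] K]
    [Algebra.IsAlgebraic ℂ[X] K] :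
    KaehlerDifferential.D ℂ K (algebraMap ℂ[X] K Polynomial.X) ≠ 0 ∧ ∀ ω : Ω[K⁄ℂ], ∃ h : K,
      ω = h • KaehlerDifferential.D ℂ K (algebraMap ℂ[X] K Polynomial.X) := by
  have := formallyEtale_of_isAlgebraic_polynomial K
  obtain ⟨e, he⟩ := exists_linearEquiv_kaehler K
  refine ⟨fun h0 => ?_, fun ω => ⟨e ω, e.injective ?_⟩⟩
  · rw [h0, map_zero] at he
    exact zero_ne_one he
  · rw [map_smul, he, smul_eq_mul, mul_one]

theorem D_aeval (x : K) (P : ℂ[X]) : KaehlerDifferential.D ℂ K (Polynomial.aeval x P) =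
    Polynomial.aeval x (derivative P) • KaehlerDifferential.D ℂ K x :=
  Derivation.map_aeval _ P x

variable {x : K} (hx : Transcendental ℂ x)
include hx

/-- The chart is the Dedekind ring ℂ[x], where dP = P′ dx. -/
theorem D_generates_of_adjoin_eq_top (hK : IntermediateField.adjoin ℂ {x} = ⊤) :
    KaehlerDifferential.D ℂ K x ≠ 0 ∧
    (∀ ω : Ω[K⁄ℂ], ∃ h : K, ω = h • KaehlerDifferential.D ℂ K x) ∧
    ∀ h : K, h • KaehlerDifferential.D ℂ K x ∈ regularDifferentials K →
      ∃ P : ℂ[X], Polynomial.aeval x P = h := by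
  let _ : Algebra ℂ[X] K := (Polynomial.aeval (R := ℂ) x).toRingHom.toAlgebra
  have : IsScalarTower ℂ ℂ[X] K := .of_algHom (Polynomial.aeval x)
  have : FaithfulSMul ℂ[X] K := (faithfulSMul_iff_algebraMap_injective _ _).2
    (transcendental_iff_injective.1 hx)
  have hmap : ∀ P : ℂ[X], algebraMap ℂ[X] K P = Polynomial.aeval x P := fun _ => rfl
  have : IsFractionRing ℂ[X] K := by
    refine IsFractionRing.of_field _ _ fun z => ?_
    have hz : z ∈ IntermediateField.adjoin ℂ {x} := by rw [hK]; trivial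
    obtain ⟨P, Q, rfl⟩ := (IntermediateField.mem_adjoin_simple_iff ℂ z).1 hz
    exact ⟨P, Q, rfl⟩
  have : Algebra.IsAlgebraic ℂ[X] K :=
    (IsFractionRing.comap_isAlgebraic_iff (A := ℂ[X]) (K := K)).2 inferInstance
  have hgen := smul_D_generates (K := K)
  rw [hmap, Polynomial.aeval_X] at hgen
  refine ⟨hgen.1, hgen.2, fun h hh => ?_⟩
  exact exists_algebraMap_eq_of_smul_mem_regularDifferentials ℂ[X] hgen.1
    (fun b => ⟨derivative b, D_aeval x b⟩) hh

/-- The chart is the integral closure ℂ[x] + ℂ[x]y. From dx = y · dx/y and 2y dy = F′ dx, that is dy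
= (F′/2) · dx/y, all its differentials are multiples of dx/y with coefficients in the ring. -/
theorem D_generates_of_sq_eq {F : ℂ[X]} (hF : IsCoprime F (derivative F))
    (hdeg : F.natDegree ≠ 0) {y : K} (hy : y ^ 2 = Polynomial.aeval x F)
    (hK : IntermediateField.adjoin ℂ {x, y} = ⊤) :
    y⁻¹ • KaehlerDifferential.D ℂ K x ≠ 0 ∧
    (∀ ω : Ω[K⁄ℂ], ∃ h : K, ω = h • y⁻¹ • KaehlerDifferential.D ℂ K x) ∧
    (∀ h : K, h • y⁻¹ • KaehlerDifferential.D ℂ K x ∈ regularDifferentials K →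
      ∃ P Q : ℂ[X], h = Polynomial.aeval x P + Polynomial.aeval x Q * y) ∧
    ∀ P Q : ℂ[X], Polynomial.aeval x P + Polynomial.aeval x Q * y = 0 → P = 0 ∧ Q = 0 := by
  have : CharZero K := charZero_of_injective_algebraMap (algebraMap ℂ K).injective
  have hFsq : Squarefree F := Polynomial.Separable.squarefree hF
  let _ : Algebra ℂ[X] K := (Polynomial.aeval (R := ℂ) x).toRingHom.toAlgebra
  have : IsScalarTower ℂ ℂ[X] K := .of_algHom (Polynomial.aeval x)
  have hinj : Function.Injective (algebraMap ℂ[X] K) := transcendental_iff_injective.1 hx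
  have : FaithfulSMul ℂ[X] K := (faithfulSMul_iff_algebraMap_injective _ _).2 hinj
  have hmap : ∀ P : ℂ[X], Polynomial.aeval x P = algebraMap ℂ[X] K P := fun _ => rfl
  let k := FractionRing ℂ[X]
  let _ : Algebra k K := FractionRing.liftAlgebra ℂ[X] K
  have : IsScalarTower ℂ[X] k K := FractionRing.isScalarTower_liftAlgebra _ _
  have : IsScalarTower ℂ k K := IsScalarTower.to₁₃₄ ℂ ℂ[X] k K
  rw [hmap] at hy
  have hint : IsIntegral k y := .of_pow two_pos (by
    rw [hy, IsScalarTower.algebraMap_apply ℂ[X] k K]; exact isIntegral_algebraMap)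
  have hKk : IntermediateField.adjoin k {y} = ⊤ := by
    rw [eq_top_iff]
    rintro z -
    have hle : IntermediateField.adjoin ℂ {x, y} ≤
        (IntermediateField.adjoin k {y}).restrictScalars ℂ := by
      rw [IntermediateField.adjoin_le_iff]
      rintro w (rfl | rfl)
      · have : w = algebraMap k K (algebraMap ℂ[X] k Polynomial.X) := by
          rw [← IsScalarTower.algebraMap_apply, ← hmap, Polynomial.aeval_X]
        rw [this]
        exact (IntermediateField.adjoin k {y}).algebraMap_mem _
      · exact IntermediateField.mem_adjoin_simple_self k w
    exact hle (by rw [hK]; trivial)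
  have : FiniteDimensional k K := by
    have h1 := IntermediateField.adjoin.finiteDimensional hint
    rw [hKk] at h1
    exact Module.Finite.equiv IntermediateField.topEquiv.toLinearEquiv
  have : Algebra.IsAlgebraic ℂ[X] K :=
    (IsFractionRing.comap_isAlgebraic_iff (A := ℂ[X]) (K := k)).2 inferInstance
  have hgen := smul_D_generates (K := K)
  rw [← hmap, Polynomial.aeval_X] at hgen
  have hy0 : y ≠ 0 := by
    rintro rfl
    have : F = 0 := hinj (by rw [← hy, map_zero]; ring)
    exact hFsq.ne_zero this
  have hω₀ : y⁻¹ • KaehlerDifferential.D ℂ K x ≠ 0 := smul_ne_zero (inv_ne_zero hy0) hgen.1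
  refine ⟨hω₀, fun ω => ?_, fun h hh => ?_, fun P Q hPQ => ?_⟩
  · obtain ⟨h, rfl⟩ := hgen.2 ω
    refine ⟨h * y, ?_⟩
    rw [smul_smul, mul_assoc, mul_inv_cancel₀ hy0, mul_one]
  · have := integralClosure.isDedekindDomain ℂ[X] k K
    have := integralClosure.isFractionRing_of_finite_extension (A := ℂ[X]) k K
    have hyi : IsIntegral ℂ[X] y :=
      .of_pow two_pos (by rw [hy]; exact isIntegral_algebraMap)
    have h2y : (2 * y) • KaehlerDifferential.D ℂ K y =
        Polynomial.aeval x (derivative F) • KaehlerDifferential.D ℂ K x := by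
      rw [← D_aeval, hmap, ← hy, pow_two, Derivation.leibniz, ← add_smul, two_mul]
    have hDy : KaehlerDifferential.D ℂ K y = (algebraMap ℂ[X] K (Polynomial.C (1 / 2) *
        derivative F)) • y⁻¹ • KaehlerDifferential.D ℂ K x := by
      have h3 : KaehlerDifferential.D ℂ K y =
          (2 * y)⁻¹ • (2 * y) • KaehlerDifferential.D ℂ K y := by
        rw [smul_smul, inv_mul_cancel₀ (mul_ne_zero two_ne_zero hy0), one_smul]
      rw [h3, h2y, smul_smul, smul_smul]
      congr 1
      rw [map_mul, ← hmap, ← hmap, Polynomial.aeval_C, mul_inv, one_div, map_inv₀, map_ofNat]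
      ring
    obtain ⟨c, rfl⟩ := exists_algebraMap_eq_of_smul_mem_regularDifferentials
      (integralClosure ℂ[X] K) hω₀ (fun b => by
        obtain ⟨P, Q, hb⟩ := exists_eq_add_mul_of_isIntegral (k := k) hFsq hdeg hy hKk b.2
        -- The coefficient of dx/y in d(P + Qy) = P′ dx + Q′y dx + Q dy.
        have hmem : algebraMap ℂ[X] K (derivative P) * y +
            algebraMap ℂ[X] K (derivative Q) * y ^ 2 +
            algebraMap ℂ[X] K (Q * (Polynomial.C (1 / 2) * derivative F)) ∈
              integralClosure ℂ[X] K :=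
          add_mem (add_mem (mul_mem (algebraMap_mem _ _) hyi)
            (mul_mem (algebraMap_mem _ _) (pow_mem hyi 2))) (algebraMap_mem _ _)
        refine ⟨⟨_, hmem⟩, ?_⟩
        change KaehlerDifferential.D ℂ K (b : K) = (_ + _ : K) • _
        rw [hb, map_add, Derivation.leibniz, hDy, ← hmap P, ← hmap Q, D_aeval, D_aeval, hmap Q]
        simp only [smul_smul, ← add_smul]
        congr 1
        rw [map_mul _ Q, ← hmap, ← hmap, ← hmap, ← hmap]
        field_simp
        ring) hh
    exact exists_eq_add_mul_of_isIntegral (k := k) hFsq hdeg hy hKk c.2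
  · have hQ : Q = 0 := by
      by_contra hQ
      have hQ' : algebraMap ℂ[X] K Q ≠ 0 := by
        rwa [Ne, FaithfulSMul.algebraMap_eq_zero_iff]
      apply notMem_range_of_sq_eq (k := k) hFsq hdeg hy
      refine ⟨-(algebraMap ℂ[X] k P) / algebraMap ℂ[X] k Q, ?_⟩
      rw [map_div₀, map_neg, ← IsScalarTower.algebraMap_apply, ← IsScalarTower.algebraMap_apply,
        div_eq_iff hQ', mul_comm, ← hmap, ← hmap]
      linear_combination -hPQ
    subst hQ
    rw [map_zero, zero_mul, add_zero] at hPQ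
    exact ⟨hinj (by rw [map_zero, ← hPQ]; rfl), rfl⟩

end Charts
end PlaneCurve

/-! ### Gluing the charts at x and 1/x -/

namespace PlaneCurve

section Genus

open Polynomial

/-- The hypothesis is the equation P(x) = Q(1/x) with denominators cleared. Reversal does not raise
the degree, so P has degree zero. -/
theorem exists_eq_C_of_mul_X_pow_eq_reverse {P Q : ℂ[X]}
    (h : P * Polynomial.X ^ Q.natDegree = Q.reverse) : ∃ c, P = Polynomial.C c := by
  by_cases hP : P = 0
  · exact ⟨0, by rw [hP, map_zero]⟩
  · have h1 := congrArg natDegree h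
    rw [natDegree_mul hP (pow_ne_zero _ Polynomial.X_ne_zero), natDegree_X_pow] at h1
    have h2 := reverse_natDegree_le Q
    exact ⟨_, eq_C_of_natDegree_eq_zero (by omega)⟩

theorem eq_zero_of_X_sq_mul_eq_C {P : ℂ[X]} {c : ℂ}
    (h : P * Polynomial.X ^ 2 = Polynomial.C c) : P = 0 := by
  by_contra hP
  have h1 := congrArg natDegree h
  rw [natDegree_mul hP (pow_ne_zero _ Polynomial.X_ne_zero), natDegree_X_pow, natDegree_C] at h1
  omega

variable {K : Type} [Field K] [Algebra ℂ K]

theorem aeval_inv_eq (x : K) (P : ℂ[X]) (hx : x ≠ 0) : Polynomial.aeval x⁻¹ P * x ^ P.natDegree =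
    Polynomial.aeval x P.reverse := by
  let _ : Invertible x⁻¹ := ⟨x, mul_inv_cancel₀ hx, inv_mul_cancel₀ hx⟩
  have h := eval₂_reverse_mul_pow (algebraMap ℂ K) x⁻¹ P
  rw [Polynomial.aeval_def, Polynomial.aeval_def, ← h, mul_assoc, ← mul_pow, inv_mul_cancel₀ hx,
    one_pow, mul_one]
  rfl

theorem D_inv (x : K) : KaehlerDifferential.D ℂ K x⁻¹ =
    (-(x⁻¹) ^ 2) • KaehlerDifferential.D ℂ K x := by
  rw [Derivation.leibniz_inv, neg_smul]

/-- If AF + BF′ = 1, then dx/y = A y dx + 2B dy, because F = y² and F′ dx = 2y dy. Here y lies in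
`O` because it is integral over ℂ[x]. -/
theorem inv_smul_D_mem_span {x : K} (O : ValuationSubring K) (hO : ∀ c : ℂ, algebraMap ℂ K c ∈ O)
    {F : ℂ[X]} (hF : IsCoprime F (derivative F)) {y : K} (hxO : x ∈ O)
    (hy : y ^ 2 = Polynomial.aeval x F) :
    y⁻¹ • KaehlerDifferential.D ℂ K x ∈
      Submodule.span ℂ {ω : Ω[K⁄ℂ] | ∃ a ∈ O, ∃ b ∈ O, ω = a • KaehlerDifferential.D ℂ K b} := by
  have hmem : ∀ P : ℂ[X], Polynomial.aeval x P ∈ O := fun P => by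
    rw [Polynomial.aeval_eq_sum_range]
    refine sum_mem fun i _ => ?_
    rw [Algebra.smul_def]
    exact mul_mem (hO _) (pow_mem hxO _)
  have hyO : y ∈ O := by
    rcases O.mem_or_inv_mem y with h | h
    · exact h
    · by_cases hy0 : y = 0
      · rw [hy0]; exact O.zero_mem
      · have : y = Polynomial.aeval x F * y⁻¹ := by rw [← hy]; field_simp
        rw [this]
        exact mul_mem (hmem F) h
  obtain ⟨A, B, hAB⟩ := hF
  have h2y : Polynomial.aeval x (derivative F) • KaehlerDifferential.D ℂ K x =
      (2 * y) • KaehlerDifferential.D ℂ K y := by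
    rw [← D_aeval, ← hy, pow_two, Derivation.leibniz, ← add_smul, two_mul]
  by_cases hy0 : y = 0
  · rw [hy0, inv_zero, zero_smul]; exact zero_mem _
  have hAB' := congrArg (Polynomial.aeval x) hAB
  rw [map_add, map_mul, map_mul, map_one, ← hy] at hAB'
  have key : y⁻¹ • KaehlerDifferential.D ℂ K x =
      (Polynomial.aeval x A * y) • KaehlerDifferential.D ℂ K x +
      (Polynomial.aeval x (B * 2)) • KaehlerDifferential.D ℂ K y := by
    calc y⁻¹ • KaehlerDifferential.D ℂ K x
        = (y⁻¹ * (Polynomial.aeval x A * y ^ 2 +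
          Polynomial.aeval x B * Polynomial.aeval x (derivative F))) •
          KaehlerDifferential.D ℂ K x := by rw [hAB', mul_one]
      _ = (Polynomial.aeval x A * y) • KaehlerDifferential.D ℂ K x +
          (y⁻¹ * Polynomial.aeval x B) • Polynomial.aeval x (derivative F) •
          KaehlerDifferential.D ℂ K x := by
        rw [smul_smul, ← add_smul]
        congr 1
        field_simp
      _ = _ := by
        rw [h2y, smul_smul]
        congr 2
        rw [map_mul, map_ofNat]
        field_simp
  rw [key]
  exact add_mem (Submodule.subset_span ⟨_, mul_mem (hmem A) hyO, _, hxO, rfl⟩)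
    (Submodule.subset_span ⟨_, hmem _, _, hyO, rfl⟩)

variable {x : K} (hx : Transcendental ℂ x)
include hx

theorem transcendental_inv : Transcendental ℂ x⁻¹ := fun h => hx (by simpa using h.inv)

/-- There are no regular differentials on a rational curve. -/
theorem regularDifferentials_eq_bot (hK : IntermediateField.adjoin ℂ {x} = ⊤) :
    regularDifferentials K = ⊥ := by
  have hx0 : x ≠ 0 := by
    rintro rfl
    exact hx isAlgebraic_zero
  have hK' : IntermediateField.adjoin ℂ {x⁻¹} = ⊤ := by
    rw [eq_top_iff, ← hK, IntermediateField.adjoin_le_iff, Set.singleton_subset_iff]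
    simpa using inv_mem (IntermediateField.mem_adjoin_simple_self ℂ x⁻¹)
  obtain ⟨-, h2, h3⟩ := D_generates_of_adjoin_eq_top hx hK
  obtain ⟨-, -, h3'⟩ := D_generates_of_adjoin_eq_top (transcendental_inv hx) hK'
  rw [eq_bot_iff]
  intro ω hω
  obtain ⟨h, rfl⟩ := h2 ω
  obtain ⟨P, rfl⟩ := h3 h hω
  -- In the chart at infinity, P dx = -P x² d(1/x), so -P x² is also a polynomial in 1/x. It is
  -- therefore constant, which forces P = 0.
  obtain ⟨Q, hQ⟩ := h3' (-(Polynomial.aeval x P * x ^ 2)) (by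
    convert hω using 1
    rw [D_inv, smul_smul]
    congr 1
    field_simp)
  have h4 : -P * Polynomial.X ^ 2 * Polynomial.X ^ Q.natDegree = Q.reverse := by
    apply transcendental_iff_injective.1 hx
    rw [← aeval_inv_eq x Q hx0, hQ]
    simp
  obtain ⟨c, hc⟩ := exists_eq_C_of_mul_X_pow_eq_reverse h4
  have := eq_zero_of_X_sq_mul_eq_C hc
  rw [neg_eq_zero] at this
  simp [this]

/-- The regular differentials on the double cover `y ^ 2 = F(x)` of the line, where `F` has
degree `3` or `4` and `G` is the polynomial of the chart at infinity, are spanned by `dx / y`. -/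
theorem regularDifferentials_eq_span {F G : ℂ[X]} (hF : IsCoprime F (derivative F))
    (hG : IsCoprime G (derivative G)) (hFdeg : F.natDegree ≠ 0) (hGdeg : G.natDegree ≠ 0) {y : K}
    (hy : y ^ 2 = Polynomial.aeval x F) (hFG : Polynomial.aeval x F =
      x ^ 4 * Polynomial.aeval x⁻¹ G) (hK : IntermediateField.adjoin ℂ {x, y} = ⊤) :
    y⁻¹ • KaehlerDifferential.D ℂ K x ≠ 0 ∧
    regularDifferentials K = Submodule.span ℂ {y⁻¹ • KaehlerDifferential.D ℂ K x} := by
  have hx0 : x ≠ 0 := by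
    rintro rfl
    exact hx isAlgebraic_zero
  obtain ⟨h1, h2, h3, h4⟩ := D_generates_of_sq_eq hx hF hFdeg hy hK
  -- At infinity the coordinates are 1/x and y/x².
  have hy' : (y * x⁻¹ ^ 2) ^ 2 = Polynomial.aeval x⁻¹ G := by
    rw [mul_pow, hy, hFG]; field_simp
  have hK' : IntermediateField.adjoin ℂ {x⁻¹, y * x⁻¹ ^ 2} = ⊤ := by
    rw [eq_top_iff, ← hK, IntermediateField.adjoin_le_iff]
    have hu : x⁻¹ ∈ IntermediateField.adjoin ℂ {x⁻¹, y * x⁻¹ ^ 2} :=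
      IntermediateField.subset_adjoin _ _ (by simp)
    have hv : y * x⁻¹ ^ 2 ∈ IntermediateField.adjoin ℂ {x⁻¹, y * x⁻¹ ^ 2} :=
      IntermediateField.subset_adjoin _ _ (by simp)
    rintro w (rfl | rfl)
    · simpa using inv_mem hu
    · have := mul_mem hv (pow_mem (inv_mem hu) 2)
      rwa [mul_assoc, ← mul_pow, mul_inv_cancel₀ (inv_ne_zero hx0), one_pow, mul_one] at this
  obtain ⟨-, -, h3', -⟩ := D_generates_of_sq_eq (transcendental_inv hx) hG hGdeg hy' hK'
  -- The generators of the two charts agree up to sign, so the coefficient h is integral in both.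
  have hω : (y * x⁻¹ ^ 2)⁻¹ • KaehlerDifferential.D ℂ K x⁻¹ =
      -(y⁻¹ • KaehlerDifferential.D ℂ K x) := by
    rw [D_inv, smul_smul, ← neg_smul]
    congr 1
    field_simp
  refine ⟨h1, le_antisymm ?_ ?_⟩
  · intro ω hreg
    obtain ⟨h, rfl⟩ := h2 ω
    obtain ⟨P, Q, hPQ⟩ := h3 h hreg
    obtain ⟨P', Q', hPQ'⟩ := h3' (-h) (by
      rw [hω, smul_neg, neg_smul, neg_neg]
      exact hreg)
    have hP' := aeval_inv_eq x P' hx0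
    have hQ' := aeval_inv_eq x Q' hx0
    -- Multiply P(x) + Q(x)y + P′(1/x) + Q′(1/x)y/x² = 0 by a power of x that clears denominators,
    -- then separate the parts along 1 and y. This makes P and Q x² constant, hence Q = 0.
    obtain ⟨hP0, hQ0⟩ := h4
      (P * Polynomial.X ^ P'.natDegree * Polynomial.X ^ (Q'.natDegree + 2) +
        P'.reverse * Polynomial.X ^ (Q'.natDegree + 2))
      (Q * Polynomial.X ^ 2 * Polynomial.X ^ Q'.natDegree * Polynomial.X ^ P'.natDegree +
        Q'.reverse * Polynomial.X ^ P'.natDegree) (by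
      simp only [map_add, map_mul, map_pow, Polynomial.aeval_X, ← hP', ← hQ']
      have h5 : Polynomial.aeval x P + Polynomial.aeval x Q * y + Polynomial.aeval x⁻¹ P' +
          Polynomial.aeval x⁻¹ Q' * (y * x⁻¹ ^ 2) = 0 := by
        rw [← hPQ, add_assoc, ← hPQ', add_neg_cancel]
      have h6 : x⁻¹ * x = 1 := inv_mul_cancel₀ hx0
      linear_combination (x ^ P'.natDegree * x ^ (Q'.natDegree + 2)) * h5 -
        Polynomial.aeval x⁻¹ Q' * y * x ^ P'.natDegree * x ^ Q'.natDegree *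
          (x⁻¹ * x + 1) * h6)
    rw [← add_mul] at hP0 hQ0
    have hXne : ∀ n, (Polynomial.X : ℂ[X]) ^ n ≠ 0 := fun n => pow_ne_zero _ Polynomial.X_ne_zero
    have hP1 := (mul_eq_zero.1 hP0).resolve_right (hXne _)
    have hQ1 := (mul_eq_zero.1 hQ0).resolve_right (hXne _)
    obtain ⟨c, hc⟩ := exists_eq_C_of_mul_X_pow_eq_reverse (P := -P) (Q := P')
      (by linear_combination -hP1)
    obtain ⟨d, hd⟩ := exists_eq_C_of_mul_X_pow_eq_reverse (P := -Q * Polynomial.X ^ 2) (Q := Q')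
      (by linear_combination -hQ1)
    have hQ2 : Q = 0 := neg_eq_zero.1 (eq_zero_of_X_sq_mul_eq_C hd)
    have hP2 : P = Polynomial.C (-c) := by rw [map_neg, ← hc, neg_neg]
    rw [hPQ, hQ2, hP2, map_zero, zero_mul, add_zero, Polynomial.aeval_C, algebraMap_smul]
    exact Submodule.smul_mem _ _ (Submodule.mem_span_singleton_self _)
  · rw [Submodule.span_singleton_le_iff_mem]
    simp only [regularDifferentials, Submodule.mem_iInf]
    intro O hO
    -- Every valuation ring contains x or 1/x, so one of the two charts shows that dx/y is regular
    -- there.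
    rcases O.mem_or_inv_mem x with hxO | hxO
    · exact inv_smul_D_mem_span O hO hF hxO hy
    · have := inv_smul_D_mem_span O hO hG hxO hy'
      rw [hω] at this
      simpa using neg_mem this

end Genus
end PlaneCurve

/-! ### Homogeneous equation of the curves -/

namespace Briancon

open PlaneCurve

section Form

variable {A : Type} [CommRing A]

/-- The homogenization of `s`. -/
def sForm (x y z : A) : A := x * y + z ^ 2

/-- The homogenization of `p`. -/
def pForm (x y z : A) : A := x * sForm x y z + z ^ 3

theorem map_sForm {B F : Type} [CommRing B] [FunLike F A B] [RingHomClass F A B]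
    (φ : F) (x y z : A) : φ (sForm x y z) = sForm (φ x) (φ y) (φ z) := by
  simp [sForm]

theorem map_pForm {B F : Type} [CommRing B] [FunLike F A B] [RingHomClass F A B]
    (φ : F) (x y z : A) : φ (pForm x y z) = pForm (φ x) (φ y) (φ z) := by
  simp [pForm, map_sForm]

variable [Algebra ℂ A]

/-- The homogenization of `g - t`, evaluated in an algebra. -/
noncomputable def form (t : ℂ) (x y z : A) : A :=
  pForm x y z ^ 2 * (sForm x y z ^ 2 + y * z ^ 3) -
    algebraMap ℂ A (1 / 3) * (5 * pForm x y z * sForm x y z * z ^ 5 + sForm x y z * z ^ 8) -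
    algebraMap ℂ A t * z ^ 10

theorem map_form {B : Type} [CommRing B] [Algebra ℂ B] (φ : A →ₐ[ℂ] B) (t : ℂ) (x y z : A) :
    φ (form t x y z) = form t (φ x) (φ y) (φ z) := by
  simp only [form, map_sub, map_mul, map_add, map_pow, AlgHom.commutes, map_sForm, map_pForm,
    map_ofNat]

theorem three_mul_algebraMap : 3 * algebraMap ℂ A (1 / 3) = 1 := by
  rw [← map_ofNat (algebraMap ℂ A) 3, ← map_mul]
  norm_num

theorem form_eq_expand (t : ℂ) (x y z : A) : form t x y z =
    x ^ 6 * y ^ 4 + 4 * x ^ 5 * y ^ 3 * z ^ 2 + 6 * x ^ 4 * y ^ 2 * z ^ 4 +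
    3 * x ^ 4 * y ^ 3 * z ^ 3 + 4 * x ^ 3 * y * z ^ 6 +
    algebraMap ℂ A (19 / 3) * x ^ 3 * y ^ 2 * z ^ 5 +
    algebraMap ℂ A (11 / 3) * x ^ 2 * y * z ^ 7 + 3 * x ^ 2 * y ^ 2 * z ^ 6 + x ^ 2 * z ^ 8 +
    algebraMap ℂ A (1 / 3) * x * z ^ 9 + 2 * x * y * z ^ 8 + y * z ^ 9 +
    algebraMap ℂ A (-1 - t) * z ^ 10 := by
  have h3 := three_mul_algebraMap (A := A)
  have h19 : algebraMap ℂ A (19 / 3) = 19 * algebraMap ℂ A (1 / 3) := by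
    rw [← map_ofNat (algebraMap ℂ A) 19, ← map_mul]; norm_num
  have h11 : algebraMap ℂ A (11 / 3) = 11 * algebraMap ℂ A (1 / 3) := by
    rw [← map_ofNat (algebraMap ℂ A) 11, ← map_mul]; norm_num
  have ht : algebraMap ℂ A (-1 - t) = -1 - algebraMap ℂ A t := by simp
  rw [h19, h11, ht]
  simp only [form, pForm, sForm]
  -- From here 1/3 is an indeterminate c known only through 3c = 1; the multiplier of `h3` collects
  -- the discrepancies.
  generalize algebraMap ℂ A (1 / 3) = c at h3
  linear_combination (-(8 * x ^ 3 * y ^ 2 * z ^ 5 + 7 * x ^ 2 * y * z ^ 7 +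
    2 * x * z ^ 9 + 2 * z ^ 10 + 2 * x * y * z ^ 8)) * h3

/-- The relation between `x` and `p` on the curve. -/
theorem sq_mul_form (t : ℂ) (x y z : A) : x ^ 2 * form t x y z =
    pForm x y z ^ 4 - z ^ 3 * pForm x y z ^ 3 + algebraMap ℂ A (1 / 3) * x * z ^ 5 *
      (-8 * pForm x y z ^ 2 + 4 * z ^ 3 * pForm x y z + z ^ 6) -
    algebraMap ℂ A t * x ^ 2 * z ^ 10 := by
  have h3 := three_mul_algebraMap (A := A)
  simp only [form, pForm, sForm]
  generalize algebraMap ℂ A (1 / 3) = c at h3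
  linear_combination (x * z ^ 11 + 2 * x ^ 2 * z ^ 10 + 2 * x ^ 3 * y * z ^ 8 + x ^ 3 * z ^ 9 +
    2 * x ^ 4 * y * z ^ 7 + x ^ 5 * y ^ 2 * z ^ 5) * h3

/-- All exponents are kept explicit, including 0 and 1, so that every term has the shape to which
the homogenization of a monomial applies. -/
theorem form_eq_sum (t : ℂ) (x y z : A) : form t x y z =
    algebraMap ℂ A 1 * x ^ 6 * y ^ 4 * z ^ 0 + algebraMap ℂ A 4 * x ^ 5 * y ^ 3 * z ^ 2 +
    algebraMap ℂ A 6 * x ^ 4 * y ^ 2 * z ^ 4 + algebraMap ℂ A 3 * x ^ 4 * y ^ 3 * z ^ 3 +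
    algebraMap ℂ A 4 * x ^ 3 * y ^ 1 * z ^ 6 + algebraMap ℂ A (19 / 3) * x ^ 3 * y ^ 2 * z ^ 5 +
    algebraMap ℂ A (11 / 3) * x ^ 2 * y ^ 1 * z ^ 7 + algebraMap ℂ A 3 * x ^ 2 * y ^ 2 * z ^ 6 +
    algebraMap ℂ A 1 * x ^ 2 * y ^ 0 * z ^ 8 + algebraMap ℂ A (1 / 3) * x ^ 1 * y ^ 0 * z ^ 9 +
    algebraMap ℂ A 2 * x ^ 1 * y ^ 1 * z ^ 8 + algebraMap ℂ A 1 * x ^ 0 * y ^ 1 * z ^ 9 +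
    algebraMap ℂ A (-1 - t) * x ^ 0 * y ^ 0 * z ^ 10 := by
  rw [form_eq_expand]
  simp only [map_ofNat, map_one]
  ring

end Form

/-- Enlarging the index set allows two polynomials and their sum to be homogenized over a common
set, although their supports differ. -/
theorem homogenizeTo_eq_sum (d : ℕ) (h : MvPolynomial (Fin 2) ℂ) (T : Finset (Fin 2 →₀ ℕ))
    (hT : h.support ⊆ T) : homogenizeTo d h =
      ∑ m ∈ T, (C (h.coeff m) * X 0 ^ m 0 * X 1 ^ m 1 * X 2 ^ (d - (m 0 + m 1)) : S) := by
  refine Finset.sum_subset hT fun m _ hm => ?_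
  rw [notMem_support_iff.1 hm]
  simp

theorem homogenizeTo_add (d : ℕ) (h k : MvPolynomial (Fin 2) ℂ) :
    homogenizeTo d (h + k) = homogenizeTo d h + homogenizeTo d k := by
  classical
  rw [homogenizeTo_eq_sum d h _ (Finset.subset_union_left (s₂ := k.support)),
    homogenizeTo_eq_sum d k _ (Finset.subset_union_right (s₁ := h.support)),
    homogenizeTo_eq_sum d (h + k) _ support_add, ← Finset.sum_add_distrib]
  simp only [coeff_add, map_add, add_mul]

theorem C_mul_X_pow_mul_X_pow (c : ℂ) (i j : ℕ) :
    (C c * X 0 ^ i * X 1 ^ j : MvPolynomial (Fin 2) ℂ) =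
      monomial (Finsupp.single 0 i + Finsupp.single 1 j) c := by
  rw [X_pow_eq_monomial, X_pow_eq_monomial, C_mul_monomial, monomial_mul]; simp

theorem homogenizeTo_monomial (d i j : ℕ) (c : ℂ) :
    homogenizeTo d (C c * X 0 ^ i * X 1 ^ j) =
      (C c : S) * X 0 ^ i * X 1 ^ j * X 2 ^ (d - (i + j)) := by
  rw [C_mul_X_pow_mul_X_pow, homogenizeTo_eq_sum d _ _ support_monomial_subset,
    Finset.sum_singleton, coeff_monomial]
  simp

theorem g_sub_C (t : ℂ) : g - C t = form t (X 0) (X 1) 1 := by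
  have h5 : (C (5 / 3) : MvPolynomial (Fin 2) ℂ) = 5 * C (1 / 3) := by
    rw [← map_ofNat C 5, ← C_mul]; norm_num
  simp only [g, u, p, s, form, pForm, sForm, h5, algebraMap_eq]
  ring

theorem totalDegree_g_sub_C (t : ℂ) : (g - C t).totalDegree = 10 := by
  rw [g_sub_C, form_eq_sum]
  apply le_antisymm
  · simp only [one_pow, mul_one, algebraMap_eq]
    have key : ∀ (c : ℂ) (i j : ℕ), i + j ≤ 10 →
        (C c * X 0 ^ i * X 1 ^ j : MvPolynomial (Fin 2) ℂ).totalDegree ≤ 10 := by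
      intro c i j hij
      refine (totalDegree_mul _ _).trans ?_
      grw [totalDegree_mul, totalDegree_C, totalDegree_X_pow, totalDegree_X_pow]
      omega
    have hadd : ∀ a b : MvPolynomial (Fin 2) ℂ, a.totalDegree ≤ 10 → b.totalDegree ≤ 10 →
        (a + b).totalDegree ≤ 10 := fun a b ha hb => (totalDegree_add a b).trans (max_le ha hb)
    iterate 12 refine hadd _ _ ?_ (key _ _ _ (by norm_num))
    exact key _ _ _ (by norm_num)
  -- The monomial x⁶y⁴ has coefficient 1 and reaches degree 10.
  · have h := le_totalDegree (p := form t (X 0) (X 1) (1 : MvPolynomial (Fin 2) ℂ))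
      (s := Finsupp.single 0 6 + Finsupp.single 1 4) ?_
    · rw [form_eq_sum] at h
      refine le_trans ?_ h
      rw [Finsupp.sum_add_index'] <;> simp
    · rw [mem_support_iff, form_eq_sum]
      have hne : ∀ i j : ℕ, (Finsupp.single 0 i + Finsupp.single 1 j : Fin 2 →₀ ℕ) =
          Finsupp.single 0 6 + Finsupp.single 1 4 ↔ i = 6 ∧ j = 4 := by
        intro i j
        refine ⟨fun h => ⟨?_, ?_⟩, fun h => by rw [h.1, h.2]⟩
        · simpa using DFunLike.congr_fun h 0
        · simpa using DFunLike.congr_fun h 1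
      simp only [one_pow, mul_one, algebraMap_eq, C_mul_X_pow_mul_X_pow, coeff_add, coeff_monomial, hne]
      norm_num

theorem curve_eq_form (t : ℂ) : curve t = form t (X 0) (X 1) (X 2) := by
  rw [curve, projectiveClosure, totalDegree_g_sub_C, g_sub_C, form_eq_sum, form_eq_sum]
  simp only [one_pow, mul_one, algebraMap_eq]
  simp only [homogenizeTo_add, homogenizeTo_monomial]

theorem isHomogeneous_sForm : (sForm (X 0) (X 1) (X 2) : S).IsHomogeneous 2 :=
  ((isHomogeneous_X ℂ 0).mul (isHomogeneous_X ℂ 1)).add (isHomogeneous_X_pow 2 2)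

theorem isHomogeneous_pForm : (pForm (X 0) (X 1) (X 2) : S).IsHomogeneous 3 :=
  ((isHomogeneous_X ℂ 0).mul isHomogeneous_sForm).add (isHomogeneous_X_pow 2 3)

theorem isHomogeneous_curve (t : ℂ) : (curve t).IsHomogeneous 10 := by
  have hz : ∀ n, (X 2 ^ n : S).IsHomogeneous n := isHomogeneous_X_pow 2
  have h0 : ∀ c, (algebraMap ℂ S c).IsHomogeneous 0 := isHomogeneous_C _
  have h5 : (5 : S).IsHomogeneous 0 := by
    rw [← map_ofNat (algebraMap ℂ S) 5]
    exact h0 5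
  have hp := isHomogeneous_pForm
  have hs := isHomogeneous_sForm
  rw [curve_eq_form]
  exact (((hp.pow 2).mul ((hs.pow 2).add ((isHomogeneous_X ℂ 1).mul (hz 3)))).sub
    ((h0 (1 / 3)).mul ((((h5.mul hp).mul hs).mul (hz 5)).add (hs.mul (hz 8))))).sub
    ((h0 t).mul (hz 10))

end Briancon

/-! ### Irreducibility -/

namespace Briancon

open PlaneCurve

section Irreducible

open Polynomial

/-- The equation of the curve in the coordinates `x` and `p`, as a polynomial in `p`. -/
noncomputable def pQuartic {A : Type} [CommRing A] [Algebra ℂ A] (t : ℂ) (x z : A) : A[X] :=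
  Polynomial.X ^ 4 - Polynomial.C (z ^ 3) * Polynomial.X ^ 3 +
    Polynomial.C (algebraMap ℂ A (1 / 3) * x * z ^ 5) *
      (-8 * Polynomial.X ^ 2 + 4 * Polynomial.C (z ^ 3) * Polynomial.X + Polynomial.C (z ^ 6)) -
    Polynomial.C (algebraMap ℂ A t * x ^ 2 * z ^ 10)

theorem coeff_quartic {R : Type} [CommRing R] (a b c d e : R) :
    (Polynomial.C a * Polynomial.X ^ 4 + Polynomial.C b * Polynomial.X ^ 3 +
      Polynomial.C c * Polynomial.X ^ 2 + Polynomial.C d * Polynomial.X + Polynomial.C e).coeff 4 =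
        a ∧
    (Polynomial.C a * Polynomial.X ^ 4 + Polynomial.C b * Polynomial.X ^ 3 +
      Polynomial.C c * Polynomial.X ^ 2 + Polynomial.C d * Polynomial.X + Polynomial.C e).coeff 1 =
        d ∧
    (Polynomial.C a * Polynomial.X ^ 4 + Polynomial.C b * Polynomial.X ^ 3 +
      Polynomial.C c * Polynomial.X ^ 2 + Polynomial.C d * Polynomial.X + Polynomial.C e).coeff 0 =
        e := by
  simp only [Polynomial.coeff_add, Polynomial.coeff_C_mul, Polynomial.coeff_X_pow,
    Polynomial.coeff_X, Polynomial.coeff_C]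
  norm_num

theorem pQuartic_eq {A : Type} [CommRing A] [Algebra ℂ A] (t : ℂ) (x z : A) :
    pQuartic t x z = Polynomial.C 1 * Polynomial.X ^ 4 + Polynomial.C (-z ^ 3) * Polynomial.X ^ 3 +
      Polynomial.C (-8 * (algebraMap ℂ A (1 / 3) * x * z ^ 5)) * Polynomial.X ^ 2 +
      Polynomial.C (algebraMap ℂ A (1 / 3) * x * z ^ 5 * 4 * z ^ 3) * Polynomial.X +
      Polynomial.C (algebraMap ℂ A (1 / 3) * x * z ^ 5 * z ^ 6 - algebraMap ℂ A t * x ^ 2 * z ^ 10) := by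
  simp only [pQuartic, Polynomial.C_mul, Polynomial.C_neg, map_sub, map_ofNat, map_one]
  ring

theorem monic_pQuartic {A : Type} [CommRing A] [Algebra ℂ A] (t : ℂ) (x z : A) :
    (pQuartic t x z).Monic := by
  rw [pQuartic_eq, map_one, one_mul]
  monicity!

theorem map_pQuartic {A B : Type} [CommRing A] [Algebra ℂ A] [CommRing B] [Algebra ℂ B]
    (φ : A →ₐ[ℂ] B) (t : ℂ) (x z : A) :
    (pQuartic t x z).map (φ : A →+* B) = pQuartic t (φ x) (φ z) := by
  have h : ∀ c : ℂ, φ (algebraMap ℂ A c) = algebraMap ℂ B c := φ.commutes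
  simp only [pQuartic, Polynomial.map_sub, Polynomial.map_add, Polynomial.map_mul,
    Polynomial.map_pow, Polynomial.map_X, Polynomial.map_C, RingHom.coe_coe, map_mul, map_pow, h,
    Polynomial.map_neg, Polynomial.map_ofNat]

theorem pQuartic_eval {A : Type} [CommRing A] [Algebra ℂ A] (t : ℂ) (x z r : A) :
    (pQuartic t x z).eval r = r ^ 4 - z ^ 3 * r ^ 3 + algebraMap ℂ A (1 / 3) * x * z ^ 5 *
      (-8 * r ^ 2 + 4 * z ^ 3 * r + z ^ 6) - algebraMap ℂ A t * x ^ 2 * z ^ 10 := by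
  simp [pQuartic]

/-- For a root r of degree n ≥ 1, r⁴ has degree 4n and the other terms at most 3n. A constant root
is 0 or 1 by setting x = 0, and there the x-derivative at 0 is 1/3 or -1. -/
theorem pQuartic_eval_ne_zero (t : ℂ) (r : ℂ[X]) :
    (pQuartic t (Polynomial.X : ℂ[X]) 1).eval r ≠ 0 := by
  intro h
  rw [pQuartic_eval] at h
  simp only [one_pow, mul_one, one_mul, Polynomial.algebraMap_eq] at h
  by_cases hr : r.natDegree = 0
  · obtain ⟨c, rfl⟩ := natDegree_eq_zero.1 hr
    have h0 := congrArg (Polynomial.eval 0) h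
    have h1 := congrArg (fun q => Polynomial.eval 0 (derivative q)) h
    simp at h0 h1
    have h2 : c ^ 3 * (c - 1) = 0 := by linear_combination h0
    rcases mul_eq_zero.1 h2 with h3 | h3
    · rw [pow_eq_zero_iff (by norm_num)] at h3
      rw [h3] at h1
      norm_num at h1
    · rw [sub_eq_zero.1 h3] at h1
      norm_num at h1
  · have h1 : r ^ 4 = r ^ 3 - Polynomial.C (1 / 3) * Polynomial.X * (-8 * r ^ 2 + 4 * r + 1) +
        Polynomial.C t * Polynomial.X ^ 2 := by linear_combination h
    have h2 : (r ^ 3 - Polynomial.C (1 / 3) * Polynomial.X * (-8 * r ^ 2 + 4 * r + 1) +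
        Polynomial.C t * Polynomial.X ^ 2).natDegree ≤ 3 * r.natDegree := by
      compute_degree
      omega
    rw [← h1, natDegree_pow] at h2
    omega

/-- At x = 0 the quartic is (p - 1)p³. A factor that does not vanish at the origin is prime to p³
there, so divides p - 1; being monic it has degree at most one, and degree one would give a root in
ℂ[x]. -/
theorem eq_one_of_mul_eq_pQuartic {t : ℂ} {a b : ℂ[X][X]} (ha : a.Monic)
    (hab : a * b = pQuartic t Polynomial.X 1) (ha0 : (a.coeff 0).eval 0 ≠ 0) : a = 1 := by
  have hmap := congrArg (Polynomial.map (evalRingHom (0 : ℂ))) hab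
  rw [Polynomial.map_mul] at hmap
  set a' := a.map (evalRingHom (0 : ℂ)) with ha'
  have hmap' : a' * b.map (evalRingHom (0 : ℂ)) =
      (Polynomial.X - Polynomial.C 1) * Polynomial.X ^ 3 := by
    rw [hmap, pQuartic_eq]
    simp
    ring
  have hcop : IsCoprime a' (Polynomial.X ^ 3) := by
    apply IsCoprime.pow_right
    apply IsCoprime.symm
    rw [Polynomial.irreducible_X.coprime_iff_not_dvd, Polynomial.X_dvd_iff]
    simpa [ha'] using ha0
  have hdvd : a' ∣ Polynomial.X - Polynomial.C 1 :=
    hcop.dvd_of_dvd_mul_right ⟨_, hmap'.symm⟩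
  have hdeg := natDegree_le_of_dvd hdvd (Polynomial.X_sub_C_ne_zero 1)
  rw [natDegree_X_sub_C, ha', ha.natDegree_map] at hdeg
  rcases Nat.le_one_iff_eq_zero_or_eq_one.1 hdeg with h | h
  · exact ha.natDegree_eq_zero.1 h
  · exfalso
    apply pQuartic_eval_ne_zero t (-a.coeff 0)
    have ha1 : a.eval (-a.coeff 0) = 0 := by
      rw [ha.eq_X_add_C h]
      simp
    rw [← hab, Polynomial.eval_mul, ha1, zero_mul]

theorem irreducible_pQuartic_one (t : ℂ) : Irreducible (pQuartic t (Polynomial.X : ℂ[X]) 1) := by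
  have hm := monic_pQuartic t (Polynomial.X : ℂ[X]) 1
  have hne : pQuartic t (Polynomial.X : ℂ[X]) 1 ≠ 1 := by
    intro h
    have h4 := congrArg (fun q => q.coeff 4) h
    simp only [pQuartic_eq, (coeff_quartic _ _ _ _ _).1, Polynomial.coeff_one] at h4
    norm_num at h4
  rw [irreducible_of_monic hm hne]
  intro a b ha hb hab
  by_cases ha0 : (a.coeff 0).eval 0 = 0
  · right
    refine eq_one_of_mul_eq_pQuartic (t := t) hb (by rw [mul_comm, hab]) fun hb0 => ?_
    -- If both factors vanished at the origin, x² would divide the constant term x/3 - t x², whose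
    -- derivative at 0 is 1/3.
    have hX : (Polynomial.X : ℂ[X]) ^ 2 ∣ (pQuartic t (Polynomial.X : ℂ[X]) 1).coeff 0 := by
      rw [← hab, Polynomial.mul_coeff_zero, pow_two]
      apply mul_dvd_mul <;> rw [Polynomial.X_dvd_iff, Polynomial.coeff_zero_eq_eval_zero] <;>
        assumption
    rw [pQuartic_eq, (coeff_quartic _ _ _ _ _).2.2] at hX
    obtain ⟨q, hq⟩ := hX
    have h1 := congrArg (fun q => (derivative q).eval 0) hq
    simp at h1
  · exact Or.inl (eq_one_of_mul_eq_pQuartic ha hab ha0)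

/-- A monic polynomial is irreducible if its specialization at z = 1 is. -/
theorem irreducible_pQuartic (t : ℂ) :
    Irreducible (pQuartic t (MvPolynomial.X 0 : MvPolynomial (Fin 2) ℂ) (MvPolynomial.X 1)) := by
  let φ : MvPolynomial (Fin 2) ℂ →ₐ[ℂ] ℂ[X] := MvPolynomial.aeval ![Polynomial.X, 1]
  refine Polynomial.Monic.irreducible_of_irreducible_map (φ : MvPolynomial (Fin 2) ℂ →+* ℂ[X]) _
    (monic_pQuartic _ _ _) ?_
  rw [map_pQuartic]
  simpa [φ] using irreducible_pQuartic_one t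

/-- The equation of the curve as a polynomial in `y`. -/
noncomputable def yQuartic (t : ℂ) : (MvPolynomial (Fin 2) ℂ)[X] :=
  form t (Polynomial.C (MvPolynomial.X 0)) Polynomial.X (Polynomial.C (MvPolynomial.X 1))

/-- The form p = x²y + xz² + z³ is affine in y, so the two quartics differ by an affine substitution
once x is inverted. -/
theorem C_mul_yQuartic (t : ℂ) : Polynomial.C (MvPolynomial.X 0 ^ 2) * yQuartic t =
    (pQuartic t (MvPolynomial.X 0 : MvPolynomial (Fin 2) ℂ) (MvPolynomial.X 1)).comp
      (Polynomial.C (MvPolynomial.X 0 ^ 2) * Polynomial.X + Polynomial.C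
        (MvPolynomial.X 0 * MvPolynomial.X 1 ^ 2 + MvPolynomial.X 1 ^ 3)) := by
  have h := sq_mul_form t (Polynomial.C (MvPolynomial.X 0 : MvPolynomial (Fin 2) ℂ)) Polynomial.X
    (Polynomial.C (MvPolynomial.X 1))
  rw [← yQuartic, ← map_pow] at h
  rw [h]
  have hc : ∀ c : ℂ, algebraMap ℂ (MvPolynomial (Fin 2) ℂ)[X] c = Polynomial.C (MvPolynomial.C c) :=
    fun _ => rfl
  simp only [pQuartic, pForm, sForm, hc, MvPolynomial.algebraMap_eq, Polynomial.sub_comp,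
    Polynomial.add_comp, Polynomial.mul_comp, Polynomial.pow_comp, Polynomial.X_comp,
    Polynomial.C_comp, Polynomial.neg_comp, Polynomial.ofNat_comp, map_mul, map_pow, map_add]
  ring

theorem yQuartic_eq (t : ℂ) : yQuartic t =
    Polynomial.C (MvPolynomial.X 0 ^ 6) * Polynomial.X ^ 4 +
    Polynomial.C (4 * MvPolynomial.X 0 ^ 5 * MvPolynomial.X 1 ^ 2 +
      3 * MvPolynomial.X 0 ^ 4 * MvPolynomial.X 1 ^ 3) * Polynomial.X ^ 3 +
    Polynomial.C (6 * MvPolynomial.X 0 ^ 4 * MvPolynomial.X 1 ^ 4 +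
      MvPolynomial.C (19 / 3) * MvPolynomial.X 0 ^ 3 * MvPolynomial.X 1 ^ 5 +
      3 * MvPolynomial.X 0 ^ 2 * MvPolynomial.X 1 ^ 6) * Polynomial.X ^ 2 +
    Polynomial.C (4 * MvPolynomial.X 0 ^ 3 * MvPolynomial.X 1 ^ 6 +
      MvPolynomial.C (11 / 3) * MvPolynomial.X 0 ^ 2 * MvPolynomial.X 1 ^ 7 +
      2 * MvPolynomial.X 0 * MvPolynomial.X 1 ^ 8 + MvPolynomial.X 1 ^ 9) * Polynomial.X +
    Polynomial.C (MvPolynomial.X 0 ^ 2 * MvPolynomial.X 1 ^ 8 +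
      MvPolynomial.C (1 / 3) * MvPolynomial.X 0 * MvPolynomial.X 1 ^ 9 +
      MvPolynomial.C (-1 - t) * MvPolynomial.X 1 ^ 10) := by
  have hc : ∀ c : ℂ, algebraMap ℂ (MvPolynomial (Fin 2) ℂ)[X] c = Polynomial.C (MvPolynomial.C c) :=
    fun _ => rfl
  rw [yQuartic, form_eq_expand]
  simp only [hc, map_mul, map_pow, map_add, map_ofNat]
  ring

/-- The leading coefficient is x⁶, so a nonunit common divisor is divisible by x; but the
coefficient of y is 1 at x = 0, z = 1. -/
theorem isPrimitive_yQuartic (t : ℂ) : (yQuartic t).IsPrimitive := by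
  intro r hr
  rw [Polynomial.C_dvd_iff_dvd_coeff] at hr
  have h4 := hr 4
  have h1 := hr 1
  rw [yQuartic_eq, (coeff_quartic _ _ _ _ _).1] at h4
  rw [yQuartic_eq, (coeff_quartic _ _ _ _ _).2.1] at h1
  obtain ⟨i, -, hi⟩ := (dvd_prime_pow (MvPolynomial.X_prime) 6).1 h4
  rcases Nat.eq_zero_or_pos i with rfl | hi0
  · rw [pow_zero] at hi
    exact hi.symm.isUnit isUnit_one
  · exfalso
    have hX : (MvPolynomial.X 0 : MvPolynomial (Fin 2) ℂ) ∣ r :=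
      (dvd_pow_self _ hi0.ne').trans hi.symm.dvd
    have h2 := map_dvd (MvPolynomial.eval ![(0 : ℂ), 1]) (hX.trans h1)
    simp at h2

/-- Gauss's lemma carries irreducibility of the p-quartic to the fraction field, where the affine
substitution is an automorphism, and then back down for the primitive y-quartic. -/
theorem irreducible_yQuartic (t : ℂ) : Irreducible (yQuartic t) := by
  let R := MvPolynomial (Fin 2) ℂ
  let L := FractionRing R
  rw [(isPrimitive_yQuartic t).irreducible_iff_irreducible_map_fraction_map (K := L)]
  have hG := (monic_pQuartic t (MvPolynomial.X 0 : R)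
    (MvPolynomial.X 1)).irreducible_iff_irreducible_map_fraction_map (K := L) |>.1
    (irreducible_pQuartic t)
  have h := congrArg (Polynomial.map (algebraMap R L)) (C_mul_yQuartic t)
  rw [Polynomial.map_mul, Polynomial.map_C, Polynomial.map_comp, Polynomial.map_add,
    Polynomial.map_mul, Polynomial.map_C, Polynomial.map_C, Polynomial.map_X] at h
  have ha : algebraMap R L (MvPolynomial.X 0 ^ 2) ≠ 0 := by
    rw [Ne, FaithfulSMul.algebraMap_eq_zero_iff]
    exact pow_ne_zero _ (MvPolynomial.X_ne_zero _)
  let _ : Invertible (algebraMap R L (MvPolynomial.X 0 ^ 2)) := invertibleOfNonzero ha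
  rw [← irreducible_isUnit_mul (Polynomial.isUnit_C.2 ha.isUnit), h]
  exact (MulEquiv.irreducible_iff (Polynomial.algEquivCMulXAddC _ _)).2 hG

theorem irreducible_curve (t : ℂ) : Irreducible (curve t) := by
  -- The swap is needed because `finSuccEquiv` singles out the variable of index 0, and here that
  -- should be y.
  let e := (MvPolynomial.renameEquiv ℂ (Equiv.swap (0 : Fin 3) 1)).trans
    (MvPolynomial.finSuccEquiv ℂ 2)
  rw [← MulEquiv.irreducible_iff e]
  have h0 : e (MvPolynomial.X 0) = Polynomial.C (MvPolynomial.X 0) := by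
    have : Equiv.swap (0 : Fin 3) 1 0 = Fin.succ 0 := by decide
    simp only [e, AlgEquiv.trans_apply, MvPolynomial.renameEquiv_apply, MvPolynomial.rename_X, this,
      MvPolynomial.finSuccEquiv_X_succ]
  have h1 : e (MvPolynomial.X 1) = Polynomial.X := by
    simp [e, MvPolynomial.finSuccEquiv_X_zero]
  have h2 : e (MvPolynomial.X 2) = Polynomial.C (MvPolynomial.X 1) := by
    have : Equiv.swap (0 : Fin 3) 1 2 = Fin.succ 1 := by decide
    simp only [e, AlgEquiv.trans_apply, MvPolynomial.renameEquiv_apply, MvPolynomial.rename_X, this,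
      MvPolynomial.finSuccEquiv_X_succ]
  have h := irreducible_yQuartic t
  rw [curve_eq_form, show e (form t (MvPolynomial.X 0) (MvPolynomial.X 1) (MvPolynomial.X 2)) =
    (e : S →ₐ[ℂ] _) (form t (MvPolynomial.X 0) (MvPolynomial.X 1) (MvPolynomial.X 2)) from rfl, map_form]
  rw [AlgEquiv.coe_toAlgHom, h0, h1, h2]
  exact h

end Irreducible

theorem isReducedCurve_curve (t : ℂ) : IsReducedCurve (curve t) 10 :=
  ⟨isHomogeneous_curve t, by norm_num, (irreducible_curve t).squarefree⟩

end Briancon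

/-! ### Affine generators of the function field -/

namespace PlaneCurve

theorem aeval_mul_of_isHomogeneous {A : Type} [CommRing A] [Algebra ℂ A] {a : S} {k : ℕ}
    (ha : a.IsHomogeneous k) (c : A) (v : Fin 3 → A) :
    aeval (fun i => c * v i) a = c ^ k * aeval v a := by
  rw [aeval_def, aeval_def, eval₂_eq, eval₂_eq, Finset.mul_sum]
  refine Finset.sum_congr rfl fun d hd => ?_
  have hdeg : ∑ i ∈ d.support, d i = k :=
    (ha.degree_eq_sum_deg_support hd).symm
  simp only [mul_pow, Finset.prod_mul_distrib, Finset.prod_pow_eq_pow_sum, hdeg]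
  ring

/-- The function field is generated by the affine coordinates, which satisfy no equation of
degree less than that of the curve. -/
theorem exists_functionField_generators {f : S} {d : ℕ} (hf : f.IsHomogeneous d) (hd : 1 < d)
    [Fact (Irreducible f)] : ∃ x y : functionField f,
      IntermediateField.adjoin ℂ {x, y} = ⊤ ∧ aeval ![x, y, 1] f = 0 ∧
      ∀ (k : ℕ) (a : S), a.IsHomogeneous k → k < d → aeval ![x, y, 1] a = 0 → a = 0 := by
  let q : S →ₐ[ℂ] ConeField f :=
    (IsScalarTower.toAlgHom ℂ (CoordRing f) (ConeField f)).comp (Ideal.Quotient.mkₐ ℂ _)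
  have hq : ∀ a, algebraMap (CoordRing f) (ConeField f) (Ideal.Quotient.mk _ a) = q a :=
    fun _ => rfl
  have hq0 : ∀ a, q a = 0 ↔ f ∣ a := by
    intro a
    rw [← hq, FaithfulSMul.algebraMap_eq_zero_iff, Ideal.Quotient.eq_zero_iff_dvd]
  -- A nonzero multiple of f has degree at least d.
  have hdvd : ∀ (k : ℕ) (a : S), a.IsHomogeneous k → k < d → q a = 0 → a = 0 := by
    intro k a ha hk h0
    rw [hq0] at h0
    by_contra hne
    obtain ⟨b, rfl⟩ := h0
    have h1 := ha.totalDegree hne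
    rw [totalDegree_mul_of_isDomain (left_ne_zero_of_mul hne) (right_ne_zero_of_mul hne),
      hf.totalDegree (left_ne_zero_of_mul hne)] at h1
    omega
  have hz : q (X 2) ≠ 0 := fun h => X_ne_zero _ (hdvd 1 _ (isHomogeneous_X _ _) hd h)
  have hmem : ∀ i, q (X i) / q (X 2) ∈ functionField f := fun i =>
    IntermediateField.subset_adjoin _ _
      ⟨1, X i, X 2, isHomogeneous_X _ _, isHomogeneous_X _ _, rfl⟩
  -- Dehomogenization: in a quotient of two forms of the same degree the powers of z cancel, leaving
  -- a rational function of x/z and y/z.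
  have hqk : ∀ (k : ℕ) (a : S), a.IsHomogeneous k →
      q a = q (X 2) ^ k * aeval ![q (X 0) / q (X 2), q (X 1) / q (X 2), 1] a := by
    intro k a ha
    rw [← aeval_mul_of_isHomogeneous ha]
    refine DFunLike.congr_fun (MvPolynomial.algHom_ext fun i => ?_) a
    rw [aeval_X]
    fin_cases i
    · exact (mul_div_cancel₀ _ hz).symm
    · exact (mul_div_cancel₀ _ hz).symm
    · exact (mul_one _).symm
  let x : functionField f := ⟨_, hmem 0⟩
  let y : functionField f := ⟨_, hmem 1⟩
  have hval : ∀ a : S, ((aeval ![x, y, 1] a : functionField f) : ConeField f) =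
      aeval ![q (X 0) / q (X 2), q (X 1) / q (X 2), 1] a := by
    intro a
    refine (comp_aeval_apply _ (functionField f).val a).trans ?_
    refine DFunLike.congr_fun (MvPolynomial.algHom_ext fun i => ?_) a
    rw [aeval_X, aeval_X]
    fin_cases i <;> rfl
  refine ⟨x, y, ?_, ?_, ?_⟩
  · apply IntermediateField.map_injective (functionField f).val
    rw [IntermediateField.adjoin_map, ← AlgHom.fieldRange_eq_map, IntermediateField.fieldRange_val]
    apply le_antisymm
    · rw [IntermediateField.adjoin_le_iff]
      rintro w ⟨w', -, rfl⟩
      exact w'.2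
    · refine IntermediateField.adjoin_le_iff.2 ?_
      rintro w ⟨k, a, b, ha, hb, rfl⟩
      have key : ∀ a : S, aeval ![q (X 0) / q (X 2), q (X 1) / q (X 2), 1] a ∈
          IntermediateField.adjoin ℂ ((functionField f).val '' {x, y}) := by
        intro a
        induction a using MvPolynomial.induction_on with
        | C c => rw [aeval_C]; exact IntermediateField.algebraMap_mem _ c
        | add a b ha hb => rw [map_add]; exact add_mem ha hb
        | mul_X a i ha =>
          rw [map_mul, aeval_X]
          refine mul_mem ha ?_
          fin_cases i
          · exact IntermediateField.subset_adjoin _ _ ⟨x, by simp, rfl⟩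
          · exact IntermediateField.subset_adjoin _ _ ⟨y, by simp, rfl⟩
          · exact one_mem _
      rw [hq, hq, hqk k a ha, hqk k b hb, mul_div_mul_left _ _ (pow_ne_zero _ hz)]
      exact div_mem (key a) (key b)
  · apply Subtype.val_injective
    have h := hqk d f hf
    rw [(hq0 f).2 dvd_rfl, zero_eq_mul] at h
    rw [hval, h.resolve_left (pow_ne_zero _ hz)]
    rfl
  · intro k a ha hk h0
    apply hdvd k a ha hk
    rw [hqk k a ha, ← hval, h0]
    simp

end PlaneCurve

/-! ### Genera of the three curves -/

namespace Briancon

open PlaneCurve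

section Generators

variable {K : Type} [Field K] [Algebra ℂ K]

/-- On the curve, `s` is a root of a quadratic polynomial with coefficients in `ℂ[p]`. -/
theorem three_mul_mul_form (t : ℂ) (x y : K) :
    3 * (x * sForm x y 1 * form t x y 1) = 3 * pForm x y 1 ^ 3 * sForm x y 1 ^ 2 -
      (8 * pForm x y 1 ^ 2 - 4 * pForm x y 1 - 1) * sForm x y 1 -
      3 * algebraMap ℂ K t * (pForm x y 1 - 1) := by
  have h3 := three_mul_algebraMap (A := K)
  simp only [form, pForm, sForm]
  generalize algebraMap ℂ K (1 / 3) = c at h3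
  linear_combination (-(x * (x * y + 1) ^ 2 * (5 * (x * (x * y + 1) + 1) + 1))) * h3

end Generators

/-- Affine coordinates on the curve, together with the relations needed for its genus. -/
theorem exists_generators (t : ℂ) [Fact (Irreducible (curve t))] :
    ∃ x s p : functionField (curve t),
      IntermediateField.adjoin ℂ {x, s} = ⊤ ∧ x ≠ 0 ∧ s ≠ 0 ∧ p ≠ 0 ∧ p = x * s + 1 ∧
      3 * p ^ 3 * s ^ 2 - (8 * p ^ 2 - 4 * p - 1) * s - 3 * algebraMap ℂ _ t * (p - 1) = 0 ∧
      Transcendental ℂ p := by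
  obtain ⟨x, y, htop, h0, hne⟩ :=
    exists_functionField_generators (isHomogeneous_curve t) (by norm_num)
  have hx : x ≠ 0 := fun h => X_ne_zero (0 : Fin 3)
    (hne 1 (X 0) (isHomogeneous_X _ _) (by norm_num) (by rw [aeval_X]; exact h))
  have hs : sForm x y 1 ≠ 0 := fun h => by
    have := hne 2 _ isHomogeneous_sForm (by norm_num) (by rw [map_sForm]; simpa using h)
    have := congrArg (aeval ![(0 : ℂ), 0, 1]) this
    rw [map_sForm] at this
    simp [sForm] at this
  -- If p = c on the curve, the cubic form of p - c would vanish on a curve of degree 10, hence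
  -- identically; but its value at (1, 1, 0) is 1.
  have hpc : ∀ c : ℂ, pForm x y 1 ≠ algebraMap ℂ _ c := fun c h => by
    have := hne 3 (pForm (X 0) (X 1) (X 2) - C c * X 2 ^ 3)
      (isHomogeneous_pForm.sub (isHomogeneous_C_mul_X_pow c 2 3)) (by norm_num) (by
        rw [map_sub, map_pForm, map_mul, map_pow, aeval_C]
        simpa [sub_eq_zero] using h)
    have := congrArg (aeval ![(1 : ℂ), 1, 0]) this
    rw [map_sub, map_pForm] at this
    simp [pForm, sForm] at this
  refine ⟨x, sForm x y 1, pForm x y 1, ?_, hx, hs, ?_, ?_, ?_, ?_⟩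
  · rw [eq_top_iff, ← htop, IntermediateField.adjoin_le_iff]
    have h1 : x ∈ IntermediateField.adjoin ℂ {x, sForm x y 1} :=
      IntermediateField.subset_adjoin _ _ (by simp)
    have h2 : sForm x y 1 ∈ IntermediateField.adjoin ℂ {x, sForm x y 1} :=
      IntermediateField.subset_adjoin _ _ (by simp)
    rintro w (rfl | rfl)
    · exact h1
    · have h3 : (sForm x w 1 - 1) / x = w := by
        rw [sForm, div_eq_iff hx]; ring
      have h4 := div_mem (sub_mem h2 (one_mem _)) h1
      rwa [h3] at h4
  · simpa using hpc 0
  · simp [pForm]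
  · rw [← three_mul_mul_form]
    have h1 : aeval ![x, y, 1] (form t (X 0) (X 1) (X 2) : S) = 0 := by
      rw [← curve_eq_form]
      exact h0
    rw [map_form, aeval_X, aeval_X, aeval_X] at h1
    have h2 : form t x y 1 = 0 := h1
    rw [h2]
    ring
  -- Over the algebraically closed field ℂ an algebraic element is a constant.
  · intro halg
    obtain ⟨c, hc⟩ := minpoly.mem_range_of_degree_eq_one ℂ (pForm x y 1)
      (IsAlgClosed.degree_eq_one_of_irreducible ℂ (minpoly.irreducible halg.isIntegral))
    exact hpc c hc.symm

section Genus

open Polynomial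

theorem adjoin_eq_top_of_mem {K : Type} [Field K] [Algebra ℂ K] {x s p : K}
    (hK : IntermediateField.adjoin ℂ {x, s} = ⊤) (hs : s ≠ 0) (hp : p = x * s + 1)
    {L : IntermediateField ℂ K} (hpL : p ∈ L) (hsL : s ∈ L) : L = ⊤ := by
  rw [eq_top_iff, ← hK, IntermediateField.adjoin_le_iff]
  rintro w (rfl | rfl)
  · have : (p - 1) / s = w := by rw [hp, add_sub_cancel_right, mul_div_cancel_right₀ _ hs]
    rw [← this]
    exact div_mem (sub_mem hpL (one_mem L)) hsL
  · exact hsL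

theorem hasGeometricGenus_zero : HasGeometricGenus (curve 0) 0 := by
  have : Fact (Irreducible (curve 0)) := ⟨irreducible_curve 0⟩
  refine ⟨this, ?_⟩
  obtain ⟨x, s, p, hK, hx, hs, hp, hpx, hrel, htr⟩ := exists_generators 0
  rw [map_zero, mul_zero, zero_mul, sub_zero] at hrel
  -- For t = 0 a factor s ≠ 0 cancels from the quadratic relation.
  have hrel' : s = (8 * p ^ 2 - 4 * p - 1) / (3 * p ^ 3) := by
    have : CharZero (functionField (curve 0)) :=
      charZero_of_injective_algebraMap (algebraMap ℂ (functionField (curve 0))).injective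
    have h3 : (3 : functionField (curve 0)) ≠ 0 := three_ne_zero
    rw [eq_div_iff (mul_ne_zero h3 (pow_ne_zero _ hp))]
    apply mul_left_cancel₀ hs
    linear_combination hrel
  have htop : IntermediateField.adjoin ℂ {p} = ⊤ := by
    have hpL := IntermediateField.mem_adjoin_simple_self ℂ p
    refine adjoin_eq_top_of_mem hK hs hpx hpL ?_
    rw [hrel']
    exact div_mem (sub_mem (sub_mem (mul_mem (ofNat_mem _ 8) (pow_mem hpL 2))
      (mul_mem (ofNat_mem _ 4) hpL)) (one_mem _)) (mul_mem (ofNat_mem _ 3) (pow_mem hpL 3))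
  rw [geometricGenus, regularDifferentials_eq_bot htr htop, rank_bot, Nat.cast_zero]

/-- The square root of the discriminant of the quadratic polynomial with root `s`. -/
theorem sq_discriminant {K : Type} [Field K] [Algebra ℂ K] {t : ℂ} {s p : K}
    (h : 3 * p ^ 3 * s ^ 2 - (8 * p ^ 2 - 4 * p - 1) * s - 3 * algebraMap ℂ K t * (p - 1) = 0) :
    (6 * p ^ 3 * s - (8 * p ^ 2 - 4 * p - 1)) ^ 2 =
      algebraMap ℂ K (64 + 36 * t) * (p ^ 4 - p ^ 3) + 8 * p + 1 := by
  rw [map_add, map_mul, map_ofNat, map_ofNat]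
  linear_combination (12 * p ^ 3) * h

theorem mem_of_discriminant_mem {K : Type} [Field K] [Algebra ℂ K] {s p : K} (hp : p ≠ 0)
    {L : IntermediateField ℂ K} (hpL : p ∈ L)
    (hw : 6 * p ^ 3 * s - (8 * p ^ 2 - 4 * p - 1) ∈ L) : s ∈ L := by
  have : CharZero K := charZero_of_injective_algebraMap (algebraMap ℂ K).injective
  have h : s = (6 * p ^ 3 * s - (8 * p ^ 2 - 4 * p - 1) + (8 * p ^ 2 - 4 * p - 1)) /
      (6 * p ^ 3) := by
    field_simp
    ring
  rw [h]
  exact div_mem (add_mem hw (sub_mem (sub_mem (mul_mem (ofNat_mem _ 8) (pow_mem hpL 2))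
    (mul_mem (ofNat_mem _ 4) hpL)) (one_mem _))) (mul_mem (ofNat_mem _ 6) (pow_mem hpL 3))

theorem hasGeometricGenus_special : HasGeometricGenus (curve (-16 / 9)) 0 := by
  have : Fact (Irreducible (curve (-16 / 9))) := ⟨irreducible_curve _⟩
  refine ⟨this, ?_⟩
  obtain ⟨x, s, p, hK, hx, hs, hp, hpx, hrel, htr⟩ := exists_generators (-16 / 9)
  have hsq := sq_discriminant hrel
  set w := 6 * p ^ 3 * s - (8 * p ^ 2 - 4 * p - 1) with hw
  -- At t = -16/9 the coefficient 64 + 36t vanishes, leaving w² = 8p + 1.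
  have hpw : p = algebraMap ℂ _ (1 / 8) * (w ^ 2 - 1) := by
    have h8 : algebraMap ℂ (functionField (curve (-16 / 9))) (1 / 8) * 8 = 1 := by
      rw [← map_ofNat (algebraMap ℂ (functionField (curve (-16 / 9)))) 8, ← map_mul]
      norm_num
    rw [hsq, show (64 + 36 * (-16 / 9) : ℂ) = 0 by norm_num, map_zero]
    linear_combination -p * h8
  have hwtr : Transcendental ℂ w := fun halg => htr <| by
    rw [hpw]
    exact (isAlgebraic_algebraMap _).mul ((halg.pow 2).sub isAlgebraic_one)
  have htop : IntermediateField.adjoin ℂ {w} = ⊤ := by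
    have hwL := IntermediateField.mem_adjoin_simple_self ℂ w
    have hpL : p ∈ IntermediateField.adjoin ℂ {w} := by
      have := mul_mem ((IntermediateField.adjoin ℂ {w}).algebraMap_mem (1 / 8))
        (sub_mem (pow_mem hwL 2) (one_mem _))
      rwa [← hpw] at this
    exact adjoin_eq_top_of_mem hK hs hpx hpL (mem_of_discriminant_mem hp hpL hwL)
  rw [geometricGenus, regularDifferentials_eq_bot hwtr htop, rank_bot, Nat.cast_zero]

theorem isCoprime_of_mul_add_mul_eq_C {F G A B : ℂ[X]} {c : ℂ} (hc : c ≠ 0)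
    (h : A * F + B * G = Polynomial.C c) : IsCoprime F G :=
  ⟨Polynomial.C c⁻¹ * A, Polynomial.C c⁻¹ * B, by
    rw [mul_assoc, mul_assoc, ← mul_add, h, ← Polynomial.C_mul, inv_mul_cancel₀ hc,
      Polynomial.C_1]⟩

theorem hasGeometricGenus_one : HasGeometricGenus (curve 1) 1 := by
  have : Fact (Irreducible (curve 1)) := ⟨irreducible_curve _⟩
  refine ⟨this, ?_⟩
  obtain ⟨x, s, p, hK, hx, hs, hp, hpx, hrel, htr⟩ := exists_generators 1
  have hsq := sq_discriminant hrel
  set w := 6 * p ^ 3 * s - (8 * p ^ 2 - 4 * p - 1) with hw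
  have htop : IntermediateField.adjoin ℂ {p, w} = ⊤ := by
    have hpL : p ∈ IntermediateField.adjoin ℂ {p, w} :=
      IntermediateField.subset_adjoin _ _ (by simp)
    have hwL : w ∈ IntermediateField.adjoin ℂ {p, w} :=
      IntermediateField.subset_adjoin _ _ (by simp)
    exact adjoin_eq_top_of_mem hK hs hpx hpL (mem_of_discriminant_mem hp hpL hwL)
  -- `F` is the discriminant at t = 1, and G(x) = x⁴F(1/x). The Bézout certificates below show that
  -- neither has a multiple root.
  let F : ℂ[X] := 100 * Polynomial.X ^ 4 - 100 * Polynomial.X ^ 3 + 8 * Polynomial.X + 1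
  let G : ℂ[X] := Polynomial.X ^ 4 + 8 * Polynomial.X ^ 3 - 100 * Polynomial.X + 100
  have hF : IsCoprime F (derivative F) := by
    refine isCoprime_of_mul_add_mul_eq_C (c := -675)
      (A := -1875 + 10000 * Polynomial.X - 10000 * Polynomial.X ^ 2)
      (B := 150 + 625 * Polynomial.X - 3125 * Polynomial.X ^ 2 + 2500 * Polynomial.X ^ 3)
      (by norm_num) ?_
    simp [F]
    simp only [map_ofNat]
    ring
  have hG : IsCoprime G (derivative G) := by
    refine isCoprime_of_mul_add_mul_eq_C (c := -10800)
      (A := 192 + 128 * Polynomial.X + 16 * Polynomial.X ^ 2)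
      (B := 300 - 64 * Polynomial.X - 40 * Polynomial.X ^ 2 - 4 * Polynomial.X ^ 3)
      (by norm_num) ?_
    simp [G]
    simp only [map_ofNat]
    ring
  have hFdeg : F.natDegree = 4 := by
    simp only [F]
    compute_degree!
  have hGdeg : G.natDegree = 4 := by
    simp only [G]
    compute_degree!
  have hp0 : p * p⁻¹ = 1 := mul_inv_cancel₀ hp
  obtain ⟨h1, h2⟩ := regularDifferentials_eq_span htr hF hG (by omega) (by omega) (y := w) (by
    rw [hsq]
    simp only [F, map_add, map_sub, map_mul, map_pow, Polynomial.aeval_X, map_ofNat, map_one]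
    ring) (by
    simp only [F, G, map_add, map_sub, map_mul, map_pow, Polynomial.aeval_X, map_ofNat, map_one]
    field_simp
    ring) htop
  rw [geometricGenus, h2, ← (LinearEquiv.toSpanNonzeroSingleton ℂ _ _ h1).rank_eq,
    Module.rank_self, Nat.cast_one]

end Genus

end Briancon

/-! ### Cross products and generators of the syzygy module -/

namespace PlaneCurve

section Cross

variable {R : Type} [CommRing R]

theorem mul_comm_of_cross_eq_zero {v w : Fin 3 → R} (h : crossProduct v w = 0) (i j : Fin 3) :
    v i * w j = v j * w i := by
  have h0 := congrFun h 0
  have h1 := congrFun h 1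
  have h2 := congrFun h 2
  simp only [cross_apply, Pi.zero_apply, Matrix.cons_val] at h0 h1 h2
  fin_cases i <;> fin_cases j <;> simp only [Fin.zero_eta, Fin.mk_one, Fin.reduceFinMk]
  · linear_combination h2
  · linear_combination -h1
  · linear_combination -h2
  · linear_combination h0
  · linear_combination h1
  · linear_combination -h0

variable [IsDomain R]

/-- A nonzero u parallel to both v and w would make v and w parallel. -/
theorem eq_zero_of_cross_eq_zero {u v w : Fin 3 → R} (hv : crossProduct u v = 0)
    (hw : crossProduct u w = 0) (hvw : crossProduct v w ≠ 0) : u = 0 := by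
  have h1 := mul_comm_of_cross_eq_zero hv
  have h2 := mul_comm_of_cross_eq_zero hw
  have key : ∀ k i j, u k * (v i * w j - v j * w i) = 0 := by
    intro k i j
    linear_combination w j * h1 k i - w i * h1 k j + v k * h2 i j
  funext k
  by_contra hk
  apply hvw
  have key' : ∀ i j, v i * w j - v j * w i = 0 := fun i j =>
    (mul_eq_zero.1 (key k i j)).resolve_left hk
  rw [cross_apply]
  ext i
  fin_cases i
  · exact key' 1 2
  · exact key' 2 0
  · exact key' 0 1

variable [UniqueFactorizationMonoid R]

/-- A vector parallel to a vector with coprime entries is a multiple of it. -/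
theorem exists_eq_smul_of_cross_eq_zero {v g : Fin 3 → R}
    (hg : ∀ q, (∀ i, q ∣ g i) → IsUnit q) (h : crossProduct v g = 0) : ∃ a : R, v = a • g := by
  classical
  let _ : NormalizedGCDMonoid R := Classical.choice inferInstance
  have hcomm := mul_comm_of_cross_eq_zero h
  have hu : IsUnit (Finset.univ.gcd g) := hg _ fun i => Finset.gcd_dvd (Finset.mem_univ i)
  have hj : ∃ j, g j ≠ 0 := by
    by_contra! hall
    exact not_isUnit_zero (hg 0 fun i => by rw [hall i])
  obtain ⟨j, hj⟩ := hj
  have hdvd : g j ∣ v j := by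
    -- As `g j` divides v j * g i = v i * g j for every i, it divides v j times the gcd of the
    -- entries of `g`, a unit.
    have h1 : g j ∣ Finset.univ.gcd fun i => v j * g i :=
      Finset.dvd_gcd fun i _ => ⟨v i, by rw [hcomm, mul_comm]⟩
    exact (hu.dvd_mul_right).1 (h1.trans (Finset.gcd_mul_left' _ _ _).dvd)
  obtain ⟨a, ha⟩ := hdvd
  refine ⟨a, funext fun i => mul_right_cancel₀ hj ?_⟩
  rw [hcomm, ha, Pi.smul_apply, smul_eq_mul]
  ring

/-- Cramer's rule: v, r₁ and r₂ are all orthogonal to g, so v × r₂ = a g and v × r₁ = b g. Then l v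
- a r₁ + b r₂ has zero cross product with r₁ and r₂, hence vanishes. -/
theorem exists_smul_eq_add_of_cross_eq {g r₁ r₂ v : Fin 3 → R}
    (hg : ∀ q, (∀ i, q ∣ g i) → IsUnit q) (hg0 : g ≠ 0) {l : R} (hl : l ≠ 0)
    (hcross : crossProduct r₁ r₂ = l • g) (hv : v ⬝ᵥ g = 0) :
    ∃ a b : R, l • v = a • r₁ + b • r₂ := by
  have hr₁ : r₁ ⬝ᵥ g = 0 := by
    have := dot_self_cross r₁ r₂
    rw [hcross, dotProduct_smul, smul_eq_mul] at this
    exact (mul_eq_zero.1 this).resolve_left hl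
  have hr₂ : r₂ ⬝ᵥ g = 0 := by
    have := dot_cross_self r₁ r₂
    rw [hcross, dotProduct_smul, smul_eq_mul] at this
    exact (mul_eq_zero.1 this).resolve_left hl
  obtain ⟨a, ha⟩ := exists_eq_smul_of_cross_eq_zero hg (v := crossProduct v r₂) (by
    rw [cross_cross_eq_smul_sub_smul, hv, hr₂, zero_smul, zero_smul, sub_zero])
  obtain ⟨b, hb⟩ := exists_eq_smul_of_cross_eq_zero hg (v := crossProduct v r₁) (by
    rw [cross_cross_eq_smul_sub_smul, hv, hr₁, zero_smul, zero_smul, sub_zero])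
  have hcross' : crossProduct r₂ r₁ = -(l • g) := by rw [← cross_anticomm, hcross]
  refine ⟨a, -b, ?_⟩
  rw [← sub_eq_zero]
  refine eq_zero_of_cross_eq_zero (v := r₁) (w := r₂) ?_ ?_ ?_
  · simp only [map_sub, map_add, map_smul, LinearMap.sub_apply, LinearMap.add_apply,
      LinearMap.smul_apply, hb, hcross', cross_self]
    module
  · simp only [map_sub, map_add, map_smul, LinearMap.sub_apply, LinearMap.add_apply,
      LinearMap.smul_apply, ha, hcross, cross_self]
    module
  · rw [hcross]
    exact smul_ne_zero hl hg0

end Cross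

/-- The gradient of `f`. -/
noncomputable def gradient (f : S) : Fin 3 → S := fun i => pderiv i f

theorem mem_jacobianSyzygies {f : S} {v : Fin 3 → S} :
    v ∈ jacobianSyzygies f ↔ v ⬝ᵥ gradient f = 0 := Iff.rfl

theorem gradient_ne_zero {f : S} {d : ℕ} (hf : f.IsHomogeneous d) (hd : d ≠ 0) (hf0 : f ≠ 0) :
    gradient f ≠ 0 := by
  intro h
  have hE := hf.sum_X_mul_pderiv
  have h' : ∀ i, pderiv i f = 0 := fun i => congrFun h i
  simp only [h', mul_zero, Finset.sum_const_zero] at hE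
  rw [eq_comm, smul_eq_zero] at hE
  exact hE.elim hd hf0

/-- By Euler's identity a common divisor of the partial derivatives divides f. If it is not a unit
it is associated to f, and f cannot divide a nonzero form of degree d - 1. -/
theorem isUnit_of_dvd_gradient {f : S} {d : ℕ} (hf : f.IsHomogeneous d) (hd : d ≠ 0)
    (hirr : Irreducible f) (q : S) (hq : ∀ i, q ∣ gradient f i) : IsUnit q := by
  have hE := hf.sum_X_mul_pderiv
  have hqf : q ∣ f := by
    have h1 : q ∣ d • f := by
      rw [← hE]
      exact Finset.dvd_sum fun i _ => Dvd.dvd.mul_left (hq i) _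
    rw [nsmul_eq_mul, ← map_natCast (C : ℂ →+* S) d] at h1
    have hu : IsUnit (C (d : ℂ) : S) := (isUnit_iff_ne_zero.2 (Nat.cast_ne_zero.2 hd)).map C
    rwa [hu.dvd_mul_left] at h1
  rcases hirr.dvd_iff.1 hqf with h | h
  · exact h
  · exfalso
    apply gradient_ne_zero hf hd hirr.ne_zero
    funext i
    by_contra hi
    obtain ⟨b, hb⟩ : f ∣ pderiv i f := h.dvd.trans (hq i)
    have hi' : pderiv i f ≠ 0 := hi
    have h1 := (hf.pderiv (i := i)).totalDegree hi'
    rw [hb] at h1 hi'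
    rw [totalDegree_mul_of_isDomain hirr.ne_zero (right_ne_zero_of_mul hi'),
      hf.totalDegree hirr.ne_zero] at h1
    omega

/-- A criterion for freeness: the cross product of two syzygies is a multiple of the gradient by
a nonzero constant. -/
theorem isFreeWithExponents_of_cross_eq {f : S} {d : ℕ} (hf : f.IsHomogeneous d) (hd : d ≠ 0)
    (hirr : Irreducible f) {d₁ d₂ : ℕ} (h12 : d₁ ≤ d₂) {r₁ r₂ : Fin 3 → S}
    (hr₁ : ∀ i, (r₁ i).IsHomogeneous d₁) (hr₂ : ∀ i, (r₂ i).IsHomogeneous d₂) {c : ℂ}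
    (hc : c ≠ 0) (hcross : crossProduct r₁ r₂ = (C c : S) • gradient f) :
    Submodule.span S (Set.range ![r₁, r₂]) = jacobianSyzygies f ∧
      (∀ v, Fintype.linearCombination S ![r₁, r₂] v = 0 → v = 0) ∧ IsFreeWithExponents f d₁ d₂ := by
  have hg := isUnit_of_dvd_gradient hf hd hirr
  have hg0 := gradient_ne_zero hf hd hirr.ne_zero
  have hc0 : (C c : S) ≠ 0 := by rwa [Ne, C_eq_zero]
  have hrange : Set.range ![r₁, r₂] = {r₁, r₂} := by
    rw [Matrix.range_cons, Matrix.range_cons, Matrix.range_empty, Set.union_empty]; rfl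
  have hspan : Submodule.span S (Set.range ![r₁, r₂]) = jacobianSyzygies f := by
    apply le_antisymm
    · rw [Submodule.span_le, hrange]
      rintro v (rfl | rfl)
      · have := dot_self_cross v r₂
        rw [hcross, dotProduct_smul, smul_eq_mul] at this
        exact (mul_eq_zero.1 this).resolve_left hc0
      · have := dot_cross_self r₁ v
        rw [hcross, dotProduct_smul, smul_eq_mul] at this
        exact (mul_eq_zero.1 this).resolve_left hc0
    · intro v hv
      obtain ⟨a, b, hab⟩ := exists_smul_eq_add_of_cross_eq hg hg0 hc0 hcross
        (mem_jacobianSyzygies.1 hv)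
      rw [hrange, Submodule.mem_span_pair]
      refine ⟨C c⁻¹ * a, C c⁻¹ * b, ?_⟩
      rw [mul_smul, mul_smul, ← smul_add, ← hab, smul_smul, ← C_mul, inv_mul_cancel₀ hc, C_1,
        one_smul]
  have hne : crossProduct r₁ r₂ ≠ 0 := by
    rw [hcross]
    exact smul_ne_zero hc0 hg0
  refine ⟨hspan, ?_, ?_, ![r₁, r₂], ?_, hspan, ?_⟩
  · intro v hv
    rw [Fintype.linearCombination_apply, Fin.sum_univ_two] at hv
    change v 0 • r₁ + v 1 • r₂ = 0 at hv
    -- Crossing with r₂ or r₁ isolates one coefficient, since r₁ × r₂ ≠ 0.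
    have h2 := congrArg (fun w => crossProduct w r₂) hv
    have h1 := congrArg (fun w => crossProduct r₁ w) hv
    simp only [map_add, map_smul, LinearMap.add_apply, LinearMap.smul_apply, cross_self, smul_zero,
      add_zero, zero_add, map_zero, LinearMap.zero_apply] at h1 h2
    funext i
    fin_cases i
    · exact (smul_eq_zero.1 h2).resolve_right hne
    · exact (smul_eq_zero.1 h1).resolve_right hne
  · intro i j hij
    fin_cases i <;> fin_cases j <;> simp_all
  · intro j i
    fin_cases j
    · exact hr₁ i
    · exact hr₂ i
  · intro j
    fin_cases j
    · have : ({0}ᶜ : Set (Fin 2)) = {1} := by ext i; fin_cases i <;> simp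
      intro h
      simp only [Fin.zero_eta, this, Set.image_singleton, Submodule.mem_span_singleton] at h
      obtain ⟨a, ha⟩ := h
      apply hne
      change a • r₂ = r₁ at ha
      rw [← ha, map_smul, LinearMap.smul_apply, cross_self, smul_zero]
    · have : ({1}ᶜ : Set (Fin 2)) = {0} := by ext i; fin_cases i <;> simp
      intro h
      simp only [Fin.mk_one, this, Set.image_singleton, Submodule.mem_span_singleton] at h
      obtain ⟨a, ha⟩ := h
      apply hne
      change a • r₁ = r₂ at ha
      rw [← ha, map_smul, cross_self, smul_zero]

theorem monotone_cons_three {d₁ d₂ d₃ : ℕ} (h12 : d₁ ≤ d₂) (h23 : d₂ ≤ d₃) :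
    Monotone ![d₁, d₂, d₃] := by
  rw [Fin.monotone_iff_le_succ]
  intro i
  fin_cases i
  · exact h12
  · exact h23

set_option maxHeartbeats 1000000 in
/-- A criterion for three syzygies `r₁, r₂, r₃` with one relation `h₁ r₁ + h₂ r₂ + l r₃ = 0`,
where `l` is a form of degree one, to be minimal generators of the module of syzygies. The map `φ`
is the restriction to the line `l = 0`. -/
theorem hasExponents_of_cross_eq {f : S} {d : ℕ} (hf : f.IsHomogeneous d) (hd : d ≠ 0)
    (hirr : Irreducible f) {d₁ d₂ d₃ e₁ e₂ : ℕ} (h12 : d₁ ≤ d₂) (h23 : d₂ ≤ d₃)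
    {r₁ r₂ r₃ : Fin 3 → S} (hr₁ : ∀ i, (r₁ i).IsHomogeneous d₁)
    (hr₂ : ∀ i, (r₂ i).IsHomogeneous d₂) (hr₃ : ∀ i, (r₃ i).IsHomogeneous d₃)
    {h₁ h₂ l : S} (hh₁ : h₁.IsHomogeneous e₁) (hh₂ : h₂.IsHomogeneous e₂)
    (hl : l.IsHomogeneous 1) (he₁ : 1 < e₁) (he₂ : 1 < e₂) {c : ℂ} (hc : c ≠ 0)
    (hcross : crossProduct r₁ r₂ = (C c * l) • gradient f)
    (hrel : h₁ • r₁ + h₂ • r₂ + l • r₃ = 0) {T : Type} [CommRing T] [IsDomain T]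
    [UniqueFactorizationMonoid T] (φ : S →+* T) (hφ : Function.Surjective φ) (hφl : φ l = 0)
    (hker : ∀ a, φ a = 0 → l ∣ a) (hφ₁ : φ h₁ ≠ 0) {i₀ : Fin 3}
    (hφr : φ (r₁ i₀) ≠ 0) (hcop : IsRelPrime (φ h₁) (φ h₂)) (hl0 : l ≠ 0) :
    Submodule.span S (Set.range ![r₁, r₂, r₃]) = jacobianSyzygies f ∧
      (∀ v, Fintype.linearCombination S ![r₁, r₂, r₃] v = 0 → ∃ q : S, v = q • ![h₁, h₂, l]) ∧
      HasExponents f ![d₁, d₂, d₃] := by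
  have hg := isUnit_of_dvd_gradient hf hd hirr
  have hg0 := gradient_ne_zero hf hd hirr.ne_zero
  have hc0 : (C c : S) ≠ 0 := by rwa [Ne, C_eq_zero]
  have hcl : (C c * l : S) ≠ 0 := mul_ne_zero hc0 hl0
  have hginj : ∀ a b : S, a • gradient f = b • gradient f → a = b := fun a b h =>
    smul_left_injective S hg0 h
  have hrange : Set.range ![r₁, r₂, r₃] = {r₁, r₂, r₃} := by
    rw [Matrix.range_cons, Matrix.range_cons, Matrix.range_cons, Matrix.range_empty,
      Set.union_empty]
    rfl
  have hr₃' : l • r₃ = -(h₁ • r₁ + h₂ • r₂) := by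
    rw [eq_neg_iff_add_eq_zero, add_comm, hrel]
  have h21 : crossProduct r₂ r₁ = -((C c * l) • gradient f) := by rw [← cross_anticomm, hcross]
  -- The relation gives the cross products of l r₃; cancelling l gives those of r₃.
  have h32 : crossProduct r₃ r₂ = (-(C c * h₁)) • gradient f := by
    apply smul_right_injective _ hl0
    simp only
    rw [← LinearMap.smul_apply, ← map_smul, hr₃']
    simp only [map_neg, map_add, map_smul, LinearMap.neg_apply, LinearMap.add_apply,
      LinearMap.smul_apply, hcross, cross_self]
    module
  have h31 : crossProduct r₃ r₁ = (C c * h₂) • gradient f := by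
    apply smul_right_injective _ hl0
    simp only
    rw [← LinearMap.smul_apply, ← map_smul, hr₃']
    simp only [map_neg, map_add, map_smul, LinearMap.neg_apply, LinearMap.add_apply,
      LinearMap.smul_apply, h21, cross_self]
    module
  have hspan : Submodule.span S (Set.range ![r₁, r₂, r₃]) = jacobianSyzygies f := by
    have m₁ : r₁ ∈ jacobianSyzygies f := by
      have := dot_self_cross r₁ r₂
      rw [hcross, dotProduct_smul, smul_eq_mul] at this
      exact (mul_eq_zero.1 this).resolve_left hcl
    have m₂ : r₂ ∈ jacobianSyzygies f := by
      have := dot_cross_self r₁ r₂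
      rw [hcross, dotProduct_smul, smul_eq_mul] at this
      exact (mul_eq_zero.1 this).resolve_left hcl
    have m₃ : r₃ ∈ jacobianSyzygies f := by
      have h1 : l • r₃ ∈ jacobianSyzygies f := by
        rw [hr₃']
        exact neg_mem (add_mem (Submodule.smul_mem _ _ m₁) (Submodule.smul_mem _ _ m₂))
      rw [mem_jacobianSyzygies, smul_dotProduct, smul_eq_mul] at h1
      exact (mul_eq_zero.1 h1).resolve_left hl0
    apply le_antisymm
    · rw [Submodule.span_le, hrange]
      rintro v (rfl | rfl | rfl)
      exacts [m₁, m₂, m₃]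
    · intro v hv
      obtain ⟨a, b, hab⟩ := exists_smul_eq_add_of_cross_eq hg hg0 hcl hcross
        (mem_jacobianSyzygies.1 hv)
      -- On the line l = 0 both (a, b) and (h₁, h₂) give relations between r₁ and r₂, and the entry
      -- `i₀` of r₁ is nonzero there. The pairs are thus proportional, and coprimality makes (a, b)
      -- = e(h₁, h₂) on the line.
      have h1 := congrArg φ (congrFun hab i₀)
      have h2 := congrArg φ (congrFun hrel i₀)
      simp only [Pi.add_apply, Pi.smul_apply, smul_eq_mul, Pi.zero_apply, map_add, map_mul, hφl,
        map_zero, zero_mul, mul_zero, add_zero] at h1 h2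
      have h3 : φ a * φ h₂ = φ b * φ h₁ := by
        apply mul_right_cancel₀ hφr
        linear_combination -φ h₂ * h1 - φ b * h2
      obtain ⟨e, he⟩ : φ h₁ ∣ φ a := hcop.dvd_of_dvd_mul_right (by rw [h3]; exact dvd_mul_left _ _)
      have he' : φ b = φ h₂ * e := by
        apply mul_right_cancel₀ hφ₁
        rw [← h3, he]
        ring
      obtain ⟨e, rfl⟩ := hφ e
      obtain ⟨a', ha'⟩ := hker (a - h₁ * e) (by rw [map_sub, map_mul, he, sub_self])
      obtain ⟨b', hb'⟩ := hker (b - h₂ * e) (by rw [map_sub, map_mul, he', sub_self])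
      -- Subtracting e times the relation leaves coefficients divisible by l, which then cancels.
      have h4 : (C c : S) • v = a' • r₁ + b' • r₂ - e • r₃ := by
        apply smul_right_injective _ hl0
        simp only
        calc l • (C c : S) • v = (C c * l) • v := by rw [smul_smul, mul_comm]
          _ = (h₁ * e + l * a') • r₁ + (h₂ * e + l * b') • r₂ := by
            rw [hab, ← ha', ← hb', add_sub_cancel, add_sub_cancel]
          _ = l • a' • r₁ + l • b' • r₂ + e • (h₁ • r₁ + h₂ • r₂) := by module
          _ = l • a' • r₁ + l • b' • r₂ + e • (-(l • r₃)) := by rw [hr₃', neg_neg]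
          _ = _ := by module
      have h5 : v = (C c⁻¹ : S) • ((C c : S) • v) := by
        rw [smul_smul, ← C_mul, inv_mul_cancel₀ hc, C_1, one_smul]
      rw [h5, h4, hrange]
      refine Submodule.smul_mem _ _ (sub_mem (add_mem (Submodule.smul_mem _ _ ?_)
        (Submodule.smul_mem _ _ ?_)) (Submodule.smul_mem _ _ ?_)) <;>
        exact Submodule.subset_span (by simp)
  -- For minimality: if r₁ or r₂ were redundant, h₁ or h₂ would divide the linear form l.
  have hdeg : ∀ {h b : S} {e : ℕ}, h.IsHomogeneous e → 1 < e → l ≠ h * b := by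
    rintro h b e hh he rfl
    have h1 := hl.totalDegree hl0
    rw [totalDegree_mul_of_isDomain (left_ne_zero_of_mul hl0) (right_ne_zero_of_mul hl0),
      hh.totalDegree (left_ne_zero_of_mul hl0)] at h1
    omega
  refine ⟨hspan, ?_, ?_, ![r₁, r₂, r₃], ?_, hspan, ?_⟩
  · intro v hv
    rw [Fintype.linearCombination_apply, Fin.sum_univ_three] at hv
    change v 0 • r₁ + v 1 • r₂ + v 2 • r₃ = 0 at hv
    have e2 := congrArg (fun w => crossProduct w r₂) hv
    have e1 := congrArg (fun w => crossProduct w r₁) hv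
    simp only [map_add, map_smul, LinearMap.add_apply, LinearMap.smul_apply, cross_self, smul_zero,
      add_zero, zero_add, map_zero, LinearMap.zero_apply, hcross, h21, h31, h32, smul_smul,
      ← add_smul, ← neg_smul] at e1 e2
    have e2' := (smul_eq_zero.1 e2).resolve_right hg0
    have e1' := (smul_eq_zero.1 e1).resolve_right hg0
    have k1 : v 0 * l = v 2 * h₁ := mul_left_cancel₀ hc0 (by linear_combination e2')
    have k2 : v 1 * l = v 2 * h₂ := mul_left_cancel₀ hc0 (by linear_combination -e1')
    obtain ⟨q, hq⟩ := hker (v 2) (by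
      have := congrArg φ k1
      rw [map_mul, map_mul, hφl, mul_zero, eq_comm] at this
      exact (mul_eq_zero.1 this).resolve_right hφ₁)
    refine ⟨q, funext fun i => ?_⟩
    fin_cases i
    · apply mul_right_cancel₀ hl0
      change v 0 * l = q * h₁ * l
      rw [k1, hq]; ring
    · apply mul_right_cancel₀ hl0
      change v 1 * l = q * h₂ * l
      rw [k2, hq]; ring
    · change v 2 = q * l
      rw [hq, mul_comm]
  · exact monotone_cons_three h12 h23
  · intro j i
    fin_cases j
    · exact hr₁ i
    · exact hr₂ i
    · exact hr₃ i
  · intro j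
    fin_cases j
    · have : ({0}ᶜ : Set (Fin 3)) = {1, 2} := by ext i; fin_cases i <;> simp
      intro h
      simp only [Fin.zero_eta, this, Set.image_pair, Submodule.mem_span_pair] at h
      obtain ⟨a, b, hab⟩ := h
      change a • r₂ + b • r₃ = r₁ at hab
      have h1 := hcross
      rw [← hab] at h1
      simp only [map_add, map_smul, LinearMap.add_apply, LinearMap.smul_apply, h32, cross_self,
        smul_zero, zero_add, smul_smul] at h1
      apply hdeg hh₁ he₁ (b := -b)
      apply mul_left_cancel₀ hc0
      rw [← hginj _ _ h1]
      ring
    · have : ({1}ᶜ : Set (Fin 3)) = {0, 2} := by ext i; fin_cases i <;> simp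
      intro h
      simp only [Fin.mk_one, this, Set.image_pair, Submodule.mem_span_pair] at h
      obtain ⟨a, b, hab⟩ := h
      change a • r₁ + b • r₃ = r₂ at hab
      have h1 := h21
      rw [← hab, ← neg_smul] at h1
      simp only [map_add, map_smul, LinearMap.add_apply, LinearMap.smul_apply, h31, cross_self,
        smul_zero, zero_add, smul_smul] at h1
      apply hdeg hh₂ he₂ (b := -b)
      apply mul_left_cancel₀ hc0
      linear_combination hginj _ _ h1
    · have : ({2}ᶜ : Set (Fin 3)) = {0, 1} := by ext i; fin_cases i <;> simp
      intro h
      simp only [Fin.reduceFinMk, this, Set.image_pair, Submodule.mem_span_pair] at h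
      obtain ⟨a, b, hab⟩ := h
      change a • r₁ + b • r₂ = r₃ at hab
      have h1 := h32
      rw [← hab] at h1
      simp only [map_add, map_smul, LinearMap.add_apply, LinearMap.smul_apply, hcross, cross_self,
        smul_zero, add_zero, smul_smul] at h1
      -- If r₃ were redundant, l would divide h₁, which is nonzero on the line.
      apply hφ₁
      have h2 : h₁ = l * -a := by
        apply mul_left_cancel₀ hc0
        linear_combination hginj _ _ h1
      rw [h2, map_mul, hφl, zero_mul]

end PlaneCurve

/-! ### Hilbert functions and the total Tjurina number -/

namespace PlaneCurve

theorem finrank_homogeneousSubmodule (k : ℕ) :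
    Module.finrank ℂ (homogeneousSubmodule (Fin 3) ℂ k) = (k + 2).choose 2 := by
  classical
  have hset : {d : Fin 3 →₀ ℕ | d.degree = k} =
      ((Finset.univ : Finset (Fin 3)).finsuppAntidiag k : Set (Fin 3 →₀ ℕ)) := by
    ext d
    simp [Finset.mem_finsuppAntidiag, Finsupp.degree_eq_sum]
  rw [homogeneousSubmodule_eq_finsupp_supported, hset]
  refine (Module.finrank_eq_card_basis (basisRestrictSupport ℂ _)).trans ?_
  refine (Fintype.card_coe _).trans ?_
  rw [Finset.card_finsuppAntidiag_nat_eq_choose]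
  simp only [Finset.card_univ, Fintype.card_fin]
  rw [show 3 + k - 1 = k + 2 by omega, ← Nat.choose_symm_add]

instance (k : ℕ) : Module.Finite ℂ (homogeneousSubmodule (Fin 3) ℂ k) :=
  Module.Finite.iff_fg.2 (homogeneousSubmodule_fg (Fin 3) ℂ k)

/-- The vectors of forms `v` with `v j` of degree `m - d j`. -/
noncomputable def gradedPiece {n : ℕ} (d : Fin n → ℕ) (m : ℕ) : Submodule ℂ (Fin n → S) :=
  Submodule.pi Set.univ fun j => homogeneousSubmodule (Fin 3) ℂ (m - d j)

theorem mem_gradedPiece {n : ℕ} {d : Fin n → ℕ} {m : ℕ} {v : Fin n → S} :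
    v ∈ gradedPiece d m ↔ ∀ j, (v j).IsHomogeneous (m - d j) := by
  simp [gradedPiece, Submodule.mem_pi]

noncomputable def gradedPieceEquiv {n : ℕ} (d : Fin n → ℕ) (m : ℕ) :
    gradedPiece d m ≃ₗ[ℂ] ∀ j, homogeneousSubmodule (Fin 3) ℂ (m - d j) where
  toFun v j := ⟨v.1 j, mem_gradedPiece.1 v.2 j⟩
  invFun v := ⟨fun j => (v j).1, mem_gradedPiece.2 fun j => (v j).2⟩
  map_add' _ _ := rfl
  map_smul' _ _ := rfl

instance {n : ℕ} (d : Fin n → ℕ) (m : ℕ) : Module.Finite ℂ (gradedPiece d m) :=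
  Module.Finite.equiv (gradedPieceEquiv d m).symm

theorem finrank_gradedPiece {n : ℕ} (d : Fin n → ℕ) (m : ℕ) :
    Module.finrank ℂ (gradedPiece d m) = ∑ j, (m - d j + 2).choose 2 := by
  rw [(gradedPieceEquiv d m).finrank_eq, Module.finrank_pi_fintype]
  simp only [finrank_homogeneousSubmodule]

theorem finrank_map_add_finrank_inf_ker {V W : Type} [AddCommGroup V] [Module ℂ V]
    [AddCommGroup W] [Module ℂ W] (L : V →ₗ[ℂ] W) (U : Submodule ℂ V) [Module.Finite ℂ U] :
    Module.finrank ℂ (U.map L) + Module.finrank ℂ (U ⊓ LinearMap.ker L : Submodule ℂ V) =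
      Module.finrank ℂ U := by
  rw [← LinearMap.finrank_range_add_finrank_ker (L.domRestrict U), LinearMap.range_domRestrict,
    LinearMap.ker_domRestrict]
  congr 1
  rw [← Submodule.map_comap_subtype]
  exact (Submodule.finrank_map_subtype_eq U ((LinearMap.ker L).comap U.subtype))

theorem homogeneousComponent_mul_of_isHomogeneous {a b : S} {i m : ℕ} (hb : b.IsHomogeneous i) :
    homogeneousComponent (m + i) (a * b) = homogeneousComponent m a * b := by
  classical
  let _ : GradedAlgebra (homogeneousSubmodule (Fin 3) ℂ) := MvPolynomial.gradedAlgebra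
  have h := DirectSum.coe_decompose_mul_of_right_mem_of_le (homogeneousSubmodule (Fin 3) ℂ)
    (a := a) (i := i) (n := m + i) hb (Nat.le_add_left _ _)
  rw [Nat.add_sub_cancel] at h
  have e (n : ℕ) (c : S) : ((DirectSum.decompose (homogeneousSubmodule (Fin 3) ℂ) c) n : S) =
      homogeneousComponent n c := decomposition.decompose'_apply c n
  rwa [e, e] at h

/-- The `ℂ`-linear map from the free module with basis indexed by the family `r`. -/
noncomputable def combination {n k : ℕ} (r : Fin n → Fin k → S) : (Fin n → S) →ₗ[ℂ] (Fin k → S) :=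
  (Fintype.linearCombination S r).restrictScalars ℂ

theorem combination_apply {n k : ℕ} (r : Fin n → Fin k → S) (v : Fin n → S) (i : Fin k) :
    combination r v i = ∑ j, v j * r j i := by
  simp [combination, Fintype.linearCombination_apply]

/-- Homogeneous components of a preimage give a homogeneous preimage. The inequalities e i ≤ d j ≤ m
keep the natural-number subtractions from truncating. -/
theorem map_gradedPiece {n k : ℕ} {r : Fin n → Fin k → S} {d : Fin n → ℕ} {e : Fin k → ℕ} {m : ℕ}
    (hr : ∀ j i, (r j i).IsHomogeneous (d j - e i)) (hde : ∀ j i, e i ≤ d j) (hm : ∀ j, d j ≤ m) :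
    (gradedPiece d m).map (combination r) =
      gradedPiece e m ⊓ LinearMap.range (combination r) := by
  have hdeg : ∀ j i, m - e i = m - d j + (d j - e i) := fun j i => by
    have := hde j i
    have := hm j
    omega
  ext w
  simp only [Submodule.mem_map, Submodule.mem_inf, LinearMap.mem_range]
  constructor
  · rintro ⟨v, hv, rfl⟩
    refine ⟨mem_gradedPiece.2 fun i => ?_, v, rfl⟩
    rw [combination_apply]
    refine IsHomogeneous.sum _ _ _ fun j _ => ?_
    rw [hdeg j i]
    exact (mem_gradedPiece.1 hv j).mul (hr j i)
  · rintro ⟨hw, v, rfl⟩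
    refine ⟨fun j => homogeneousComponent (m - d j) (v j),
      mem_gradedPiece.2 fun j => homogeneousComponent_isHomogeneous _ _, funext fun i => ?_⟩
    rw [combination_apply]
    have h1 := mem_gradedPiece.1 hw i
    rw [← homogeneousComponent_eq_self h1, combination_apply, map_sum]
    refine Finset.sum_congr rfl fun j _ => ?_
    rw [hdeg j i, homogeneousComponent_mul_of_isHomogeneous (hr j i)]

theorem finrank_inf_range_add_finrank_inf_ker {n k : ℕ} {r : Fin n → Fin k → S} {d : Fin n → ℕ}
    {e : Fin k → ℕ} {m : ℕ} (hr : ∀ j i, (r j i).IsHomogeneous (d j - e i))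
    (hde : ∀ j i, e i ≤ d j) (hm : ∀ j, d j ≤ m) :
    Module.finrank ℂ (gradedPiece e m ⊓ LinearMap.range (combination r) : Submodule ℂ _) +
      Module.finrank ℂ (gradedPiece d m ⊓ LinearMap.ker (combination r) : Submodule ℂ _) =
      ∑ j, (m - d j + 2).choose 2 := by
  rw [← map_gradedPiece hr hde hm, finrank_map_add_finrank_inf_ker, finrank_gradedPiece]

/-- Exactness at `gradedPiece e m`: the kernel of `q` in degree `m` is the image of `r`. -/
theorem finrank_inf_ker_add_finrank_inf_ker {n k l : ℕ} {r : Fin n → Fin k → S}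
    {q : Fin k → Fin l → S} {d : Fin n → ℕ} {e : Fin k → ℕ} {m : ℕ}
    (hqr : LinearMap.ker (combination q) = LinearMap.range (combination r))
    (hr : ∀ j i, (r j i).IsHomogeneous (d j - e i))
    (hde : ∀ j i, e i ≤ d j) (hm : ∀ j, d j ≤ m) :
    Module.finrank ℂ (gradedPiece e m ⊓ LinearMap.ker (combination q) : Submodule ℂ _) +
      Module.finrank ℂ (gradedPiece d m ⊓ LinearMap.ker (combination r) : Submodule ℂ _) =
      ∑ j, (m - d j + 2).choose 2 := by
  rw [hqr, finrank_inf_range_add_finrank_inf_ker hr hde hm]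

/-- The partial derivatives, as a family of vectors of length one. -/
noncomputable def gradientRow (f : S) : Fin 3 → Fin 1 → S := fun i _ => pderiv i f

theorem finrank_milnorComponent_add (f : S) (k : ℕ) :
    Module.finrank ℂ (milnorComponent f k) + Module.finrank ℂ
      (gradedPiece ![0] k ⊓ LinearMap.range (combination (gradientRow f)) : Submodule ℂ _) =
      (k + 2).choose 2 := by
  let L : (Fin 1 → S) →ₗ[ℂ] S ⧸ jacobianIdeal f :=
    (Ideal.Quotient.mkₐ ℂ (jacobianIdeal f)).toLinearMap ∘ₗ LinearMap.proj 0
  have hmap : (gradedPiece ![0] k).map L = milnorComponent f k := by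
    rw [milnorComponent, Submodule.map_comp]
    congr 1
    ext a
    simp only [Submodule.mem_map, LinearMap.proj_apply, mem_homogeneousSubmodule]
    constructor
    · rintro ⟨v, hv, rfl⟩
      simpa using mem_gradedPiece.1 hv 0
    · intro ha
      exact ⟨fun _ => a, mem_gradedPiece.2 fun j => by simpa using ha, rfl⟩
  have hker : LinearMap.ker L = LinearMap.range (combination (gradientRow f)) := by
    ext w
    have h1 : w ∈ LinearMap.ker L ↔ w 0 ∈ jacobianIdeal f := by
      rw [LinearMap.mem_ker]
      exact Ideal.Quotient.eq_zero_iff_mem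
    rw [h1, jacobianIdeal, Ideal.mem_span_range_iff_exists_fun, LinearMap.mem_range]
    refine exists_congr fun v => ?_
    rw [funext_iff, Fin.forall_fin_one, combination_apply]
    rfl
  rw [← hmap, ← hker, finrank_map_add_finrank_inf_ker, finrank_gradedPiece]
  simp

theorem ker_combination_gradientRow (f : S) :
    LinearMap.ker (combination (gradientRow f)) = (jacobianSyzygies f).restrictScalars ℂ := by
  ext v
  rw [LinearMap.mem_ker, funext_iff, Fin.forall_fin_one, combination_apply]
  rfl

theorem range_combination {n k : ℕ} (r : Fin n → Fin k → S) :
    LinearMap.range (combination r) = (Submodule.span S (Set.range r)).restrictScalars ℂ := by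
  rw [← Fintype.range_linearCombination]
  rfl

/-- Stated without division, so that the final dimension counts become linear arithmetic in n and
n². -/
theorem choose_two_add (n : ℕ) : 2 * (n + 2).choose 2 = (n + 1) * (n + 2) := by
  rw [Nat.choose_two_right, Nat.mul_div_cancel' (Nat.even_mul_pred_self _).two_dvd,
    Nat.add_sub_assoc (by omega), mul_comm]

/-- Dimension count in 0 → S(-13) ⊕ S(-14) → S(-9)³ → S → M(f) → 0; the shifts are the degrees of
the syzygies plus 9. -/
theorem hasTotalTjurinaNumber_of_free {f : S} (hf : f.IsHomogeneous 10) {r : Fin 2 → Fin 3 → S}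
    (hr : ∀ j i, (r j i).IsHomogeneous (![4, 5] j))
    (hspan : Submodule.span S (Set.range r) = jacobianSyzygies f)
    (hinj : ∀ v, Fintype.linearCombination S r v = 0 → v = 0) :
    HasTotalTjurinaNumber f 61 := by
  refine Filter.eventually_atTop.2 ⟨16, fun k hk => ?_⟩
  obtain ⟨n, rfl⟩ := Nat.exists_eq_add_of_le' hk
  have h0 := finrank_milnorComponent_add f (n + 16)
  have h1 := finrank_inf_range_add_finrank_inf_ker (r := gradientRow f) (d := ![9, 9, 9])
    (e := ![0]) (m := n + 16)
    (fun j i => by fin_cases j <;> fin_cases i <;> exact hf.pderiv)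
    (by decide) (fun j => by fin_cases j <;> simp)
  have h2 := finrank_inf_ker_add_finrank_inf_ker (r := r) (q := gradientRow f) (d := ![13, 14])
    (e := ![9, 9, 9]) (m := n + 16)
    (by rw [range_combination, hspan, ker_combination_gradientRow])
    (fun j i => by have := hr j i; fin_cases j <;> fin_cases i <;> exact this)
    (by decide) (fun j => by fin_cases j <;> simp)
  have h3 : LinearMap.ker (combination r) = ⊥ := (Submodule.eq_bot_iff _).2 fun v hv => hinj v hv
  rw [h3, inf_bot_eq, finrank_bot] at h2
  simp [Fin.sum_univ_succ] at h1 h2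
  have c0 := choose_two_add (n + 16)
  have c1 := choose_two_add (n + 7)
  have c2 := choose_two_add (n + 3)
  have c3 := choose_two_add (n + 2)
  ring_nf at *
  omega

/-- Dimension count in 0 → S(-16) → S(-14)² ⊕ S(-15) → S(-9)³ → S → M(f) → 0. From degree 16 on, no
shift exceeds the degree. -/
theorem hasTotalTjurinaNumber_of_mpog {f : S} (hf : f.IsHomogeneous 10) {r : Fin 3 → Fin 3 → S}
    (hr : ∀ j i, (r j i).IsHomogeneous (![5, 5, 6] j))
    (hspan : Submodule.span S (Set.range r) = jacobianSyzygies f)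
    {h : Fin 3 → S} (hh : ∀ j, (h j).IsHomogeneous (![2, 2, 1] j)) (hne : h ≠ 0)
    (hrel : Fintype.linearCombination S r h = 0)
    (hker : ∀ v, Fintype.linearCombination S r v = 0 → ∃ q : S, v = q • h) :
    HasTotalTjurinaNumber f 59 := by
  refine Filter.eventually_atTop.2 ⟨16, fun k hk => ?_⟩
  obtain ⟨n, rfl⟩ := Nat.exists_eq_add_of_le' hk
  have h0 := finrank_milnorComponent_add f (n + 16)
  have h1 := finrank_inf_range_add_finrank_inf_ker (r := gradientRow f) (d := ![9, 9, 9])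
    (e := ![0]) (m := n + 16)
    (fun j i => by fin_cases j <;> fin_cases i <;> exact hf.pderiv)
    (by decide) (fun j => by fin_cases j <;> simp)
  have h2 := finrank_inf_ker_add_finrank_inf_ker (r := r) (q := gradientRow f) (d := ![14, 14, 15])
    (e := ![9, 9, 9]) (m := n + 16)
    (by rw [range_combination, hspan, ker_combination_gradientRow])
    (fun j i => by have := hr j i; fin_cases j <;> fin_cases i <;> exact this)
    (by decide) (fun j => by fin_cases j <;> simp)
  have hc (v : Fin 1 → S) : combination ![h] v = v 0 • h := by
    ext1 i
    simp [combination_apply]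
  have h3 := finrank_inf_ker_add_finrank_inf_ker (r := ![h]) (q := r) (d := ![16])
    (e := ![14, 14, 15]) (m := n + 16)
    (by
      ext v
      rw [LinearMap.mem_range]
      constructor
      · intro hv
        obtain ⟨q, rfl⟩ := hker v hv
        exact ⟨fun _ => q, hc _⟩
      · rintro ⟨q, rfl⟩
        rw [hc]
        change Fintype.linearCombination S r (q 0 • h) = 0
        rw [map_smul, hrel, smul_zero])
    (fun j i => by have := hh i; fin_cases j; fin_cases i <;> exact this)
    (by decide) (fun j => by fin_cases j; simp)
  have h4 : LinearMap.ker (combination ![h]) = ⊥ := (Submodule.eq_bot_iff _).2 fun v hv => by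
    rw [LinearMap.mem_ker, hc] at hv
    ext1 j
    rw [Subsingleton.elim j 0]
    exact (smul_eq_zero.1 hv).resolve_right hne
  rw [h4, inf_bot_eq, finrank_bot] at h3
  simp [Fin.sum_univ_succ] at h1 h2 h3
  have c0 := choose_two_add (n + 16)
  have c1 := choose_two_add (n + 7)
  have c2 := choose_two_add (n + 2)
  have c3 := choose_two_add (n + 1)
  have c4 := choose_two_add n
  ring_nf at *
  omega

end PlaneCurve

/-! ### Restriction to a line and the criterion in degree 10 -/

namespace PlaneCurve

/-- The restriction to the line `x = b y + c z`. -/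
noncomputable def restrictToLine (b c : ℂ) : S →ₐ[ℂ] MvPolynomial (Fin 2) ℂ :=
  aeval ![C b * X 0 + C c * X 1, X 0, X 1]

/-- The extension of forms on the line `x = b y + c z` to forms not depending on `x`. -/
noncomputable def extendFromLine : MvPolynomial (Fin 2) ℂ →ₐ[ℂ] S := aeval ![X 1, X 2]

theorem restrictToLine_extendFromLine (b c : ℂ) (a : MvPolynomial (Fin 2) ℂ) :
    restrictToLine b c (extendFromLine a) = a := by
  have h : (restrictToLine b c).comp extendFromLine = AlgHom.id ℂ _ := by
    ext i
    fin_cases i <;> simp [restrictToLine, extendFromLine]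
  exact DFunLike.congr_fun h a

theorem dvd_sub_extendFromLine_restrictToLine (b c : ℂ) (a : S) :
    X 0 - C b * X 1 - C c * X 2 ∣ a - extendFromLine (restrictToLine b c a) := by
  rw [← Ideal.mem_span_singleton, ← Ideal.Quotient.mk_eq_mk_iff_sub_mem]
  set I : Ideal S := Ideal.span {X 0 - C b * X 1 - C c * X 2}
  have h : Ideal.Quotient.mkₐ ℂ I =
      (Ideal.Quotient.mkₐ ℂ I).comp (extendFromLine.comp (restrictToLine b c)) := by
    ext i
    simp only [AlgHom.comp_apply, Ideal.Quotient.mkₐ_eq_mk]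
    fin_cases i
    · rw [Ideal.Quotient.mk_eq_mk_iff_sub_mem]
      simp [restrictToLine, extendFromLine, I, ← sub_sub]
    · simp [restrictToLine, extendFromLine]
    · simp [restrictToLine, extendFromLine]
  exact DFunLike.congr_fun h a

/-- A common divisor divides powers of both variables, and these are coprime. -/
theorem isRelPrime_of_dvd_pow {p q : MvPolynomial (Fin 2) ℂ} {m n : ℕ} {a b : ℂ} (ha : a ≠ 0)
    (hb : b ≠ 0) (h0 : ∀ e, e ∣ p → e ∣ q → e ∣ C a * X 0 ^ m)
    (h1 : ∀ e, e ∣ p → e ∣ q → e ∣ C b * X 1 ^ n) : IsRelPrime p q := by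
  have hu : ∀ c : ℂ, c ≠ 0 → IsUnit (C c : MvPolynomial (Fin 2) ℂ) := fun c hc =>
    (isUnit_iff_ne_zero.2 hc).map C
  intro e hp hq
  have h0' := (hu a ha).dvd_mul_left.1 (h0 e hp hq)
  have h1' := (hu b hb).dvd_mul_left.1 (h1 e hp hq)
  have hrel : IsRelPrime (X 0 : MvPolynomial (Fin 2) ℂ) (X 1) :=
    ((X_prime (R := ℂ) (i := (0 : Fin 2))).irreducible.isRelPrime_iff_not_dvd).2 (by
      rw [X_dvd_X]
      simp)
  exact (hrel.pow (m := m) (n := n)) h0' h1'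

/-- A criterion for a curve of degree `10` to be a minimal plus-one generated curve with exponents
`(5, 5, 6)` and of total Tjurina number `59`. -/
theorem isMPOG_of_cross_eq {f : S} (hf : f.IsHomogeneous 10) (hirr : Irreducible f)
    {r₁ r₂ r₃ : Fin 3 → S} (hr₁ : ∀ i, (r₁ i).IsHomogeneous 5)
    (hr₂ : ∀ i, (r₂ i).IsHomogeneous 5) (hr₃ : ∀ i, (r₃ i).IsHomogeneous 6)
    {h₁ h₂ l : S} (hh₁ : h₁.IsHomogeneous 2) (hh₂ : h₂.IsHomogeneous 2) {α β γ c : ℂ} (hα : α ≠ 0)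
    (hl : l = C α * X 0 + C β * X 1 + C γ * X 2) (hc : c ≠ 0)
    (hcross : crossProduct r₁ r₂ = (C c * l) • gradient f)
    (hrel : h₁ • r₁ + h₂ • r₂ + l • r₃ = 0) {P Q : Fin 3 → ℂ} (hPl : eval P l = 0)
    (hP : eval P h₁ ≠ 0) (hQl : eval Q l = 0) {i₀ : Fin 3} (hQ : eval Q (r₁ i₀) ≠ 0)
    {a b : ℂ} (ha : a ≠ 0) (hb : b ≠ 0) {m n : ℕ}
    (hy : C a * X 1 ^ m ∈ Ideal.span {h₁, h₂, l}) (hz : C b * X 2 ^ n ∈ Ideal.span {h₁, h₂, l}) :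
    IsMPOGWithExponents f 5 5 6 ∧ HasTotalTjurinaNumber f 59 := by
  set φ := restrictToLine (-β / α) (-γ / α)
  have hl' : l = C α * (X 0 - C (-β / α) * X 1 - C (-γ / α) * X 2) := by
    have h1 : (C β : S) = C α * -C (-β / α) := by
      rw [← C_neg, ← C_mul]; congr 1; field_simp
    have h2 : (C γ : S) = C α * -C (-γ / α) := by
      rw [← C_neg, ← C_mul]; congr 1; field_simp
    rw [hl, h1, h2]
    ring
  have hu : IsUnit (C α : S) := (isUnit_iff_ne_zero.2 hα).map C
  have hφl : φ l = 0 := by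
    rw [hl']
    simp [φ, restrictToLine]
  have hker : ∀ a, φ a = 0 → l ∣ a := by
    intro a ha
    have h := dvd_sub_extendFromLine_restrictToLine (-β / α) (-γ / α) a
    rw [show restrictToLine (-β / α) (-γ / α) a = 0 from ha, map_zero, sub_zero] at h
    rw [hl']
    exact hu.mul_left_dvd.2 h
  -- A point of the line where q is nonzero shows that q does not vanish identically on it.
  have heval : ∀ (P : Fin 3 → ℂ) (q : S), eval P l = 0 → eval P q ≠ 0 → φ q ≠ 0 := by
    intro P q hP hq h0
    exact hq (eq_zero_of_zero_dvd (hP ▸ map_dvd (eval P) (hker q h0)))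
  have hspan : ∀ q ∈ Ideal.span {h₁, h₂, l}, ∀ e, e ∣ φ h₁ → e ∣ φ h₂ → e ∣ φ q := by
    intro q hq e he₁ he₂
    obtain ⟨u, v, w, rfl⟩ := Submodule.mem_span_triple.1 hq
    simp only [smul_eq_mul, map_add, map_mul, hφl, mul_zero, add_zero]
    exact dvd_add (he₁.mul_left _) (he₂.mul_left _)
  -- Here y and z are coordinates on the line, and powers of both lie in the ideal of the
  -- restrictions of h₁ and h₂.
  have hcop : IsRelPrime (φ h₁) (φ h₂) := by
    refine isRelPrime_of_dvd_pow (m := m) (n := n) ha hb (fun e he₁ he₂ => ?_) fun e he₁ he₂ => ?_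
    · simpa [φ, restrictToLine, algebraMap_eq] using hspan _ hy e he₁ he₂
    · simpa [φ, restrictToLine, algebraMap_eq] using hspan _ hz e he₁ he₂
  have hl0 : l ≠ 0 := by
    rw [hl']
    refine mul_ne_zero hu.ne_zero fun h => ?_
    have := congrArg (eval ![1, 0, 0]) h
    simp at this
  have hlh : l.IsHomogeneous 1 := by
    rw [hl]
    exact (((isHomogeneous_C_mul_X _ _).add (isHomogeneous_C_mul_X _ _))).add
      (isHomogeneous_C_mul_X _ _)
  obtain ⟨h1, h2, h3⟩ := hasExponents_of_cross_eq hf (by norm_num) hirr le_rfl (by norm_num)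
    hr₁ hr₂ hr₃ hh₁ hh₂ hlh one_lt_two one_lt_two hc hcross hrel φ.toRingHom
    (fun a => ⟨extendFromLine a, restrictToLine_extendFromLine _ _ a⟩) hφl hker
    (heval P h₁ hPl hP) (heval Q (r₁ i₀) hQl hQ) hcop hl0
  refine ⟨⟨⟨h3, (hf.totalDegree hirr.ne_zero).symm⟩, rfl⟩,
    hasTotalTjurinaNumber_of_mpog hf (r := ![r₁, r₂, r₃]) (fun j i => ?_) h1 (h := ![h₁, h₂, l])
      (fun j => ?_) (fun h => hl0 (congrFun h 2)) ?_ h2⟩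
  · fin_cases j
    exacts [hr₁ i, hr₂ i, hr₃ i]
  · fin_cases j
    exacts [hh₁, hh₂, hlh]
  · rw [Fintype.linearCombination_apply, Fin.sum_univ_three]
    exact hrel

end PlaneCurve

/-! ### Explicit gradient, syzygies and relations -/

namespace Briancon

open PlaneCurve

theorem isHomogeneous_ofNat {n : ℕ} [n.AtLeastTwo] :
    (OfNat.ofNat n : S).IsHomogeneous 0 := by
  rw [← map_ofNat C]
  exact isHomogeneous_C _ _

/-- Nine times the gradient of `form t`, where `a = -9 - 9 t`. -/
def gradientForm {A : Type} [CommRing A] (a x y z : A) : Fin 3 → A :=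
  ![54 * x ^ 5 * y ^ 4 + 180 * x ^ 4 * y ^ 3 * z ^ 2 + 216 * x ^ 3 * y ^ 2 * z ^ 4 +
      108 * x ^ 3 * y ^ 3 * z ^ 3 + 108 * x ^ 2 * y * z ^ 6 + 171 * x ^ 2 * y ^ 2 * z ^ 5 +
      66 * x * y * z ^ 7 + 54 * x * y ^ 2 * z ^ 6 + 18 * x * z ^ 8 + 3 * z ^ 9 + 18 * y * z ^ 8,
    36 * x ^ 6 * y ^ 3 + 108 * x ^ 5 * y ^ 2 * z ^ 2 + 108 * x ^ 4 * y * z ^ 4 +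
      81 * x ^ 4 * y ^ 2 * z ^ 3 + 36 * x ^ 3 * z ^ 6 + 114 * x ^ 3 * y * z ^ 5 +
      33 * x ^ 2 * z ^ 7 + 54 * x ^ 2 * y * z ^ 6 + 18 * x * z ^ 8 + 9 * z ^ 9,
    72 * x ^ 5 * y ^ 3 * z + 216 * x ^ 4 * y ^ 2 * z ^ 3 + 81 * x ^ 4 * y ^ 3 * z ^ 2 +
      216 * x ^ 3 * y * z ^ 5 + 285 * x ^ 3 * y ^ 2 * z ^ 4 + 231 * x ^ 2 * y * z ^ 6 +
      162 * x ^ 2 * y ^ 2 * z ^ 5 + 72 * x ^ 2 * z ^ 7 + 27 * x * z ^ 8 + 144 * x * y * z ^ 7 +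
      10 * a * z ^ 9 + 81 * y * z ^ 8]

/-- The factor 9 clears the denominators, including that of t = -16/9, so the identities below have
integer coefficients. -/
theorem nine_smul_gradient_curve (t : ℂ) :
    (9 : S) • gradient (curve t) = gradientForm (C (-9 - 9 * t)) (X 0) (X 1) (X 2) := by
  have h3 : (3 : S) * C (1 / 3) = 1 := three_mul_algebraMap (A := S)
  have h19 : (C (19 / 3) : S) = 19 * C (1 / 3) := by
    rw [← map_ofNat C 19, ← C_mul]; norm_num
  have h11 : (C (11 / 3) : S) = 11 * C (1 / 3) := by
    rw [← map_ofNat C 11, ← C_mul]; norm_num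
  have ht : (C (-9 - 9 * t) : S) = 9 * C (-1 - t) := by
    rw [← map_ofNat C 9, ← C_mul]; congr 1; ring
  have hn (n : ℕ) [n.AtLeastTwo] (i : Fin 3) : pderiv i (OfNat.ofNat n : S) = 0 := by
    rw [← map_ofNat C, pderiv_C]
  have h01 : pderiv (0 : Fin 3) (X 1 : S) = 0 := pderiv_X_of_ne (by decide)
  have h02 : pderiv (0 : Fin 3) (X 2 : S) = 0 := pderiv_X_of_ne (by decide)
  have h10 : pderiv (1 : Fin 3) (X 0 : S) = 0 := pderiv_X_of_ne (by decide)
  have h12 : pderiv (1 : Fin 3) (X 2 : S) = 0 := pderiv_X_of_ne (by decide)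
  have h20 : pderiv (2 : Fin 3) (X 0 : S) = 0 := pderiv_X_of_ne (by decide)
  have h21 : pderiv (2 : Fin 3) (X 1 : S) = 0 := pderiv_X_of_ne (by decide)
  rw [curve_eq_form, form_eq_expand, ht, algebraMap_eq, h19, h11]
  funext i
  fin_cases i <;>
    simp only [PlaneCurve.gradient, gradientForm, Pi.smul_apply, smul_eq_mul, map_add, Derivation.leibniz,
      Derivation.leibniz_pow, pderiv_C, hn, pderiv_X_self, h01, h02, h10, h12, h20, h21, smul_zero,
      mul_zero, add_zero, zero_add, nsmul_eq_mul, Nat.cast_ofNat, Fin.zero_eta, Fin.mk_one,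
      Fin.reduceFinMk, Matrix.cons_val]
  · linear_combination (171 * X 0 ^ 2 * X 1 ^ 2 * X 2 ^ 5 + 66 * X 0 * X 1 * X 2 ^ 7 +
      3 * X 2 ^ 9) * h3
  · linear_combination (114 * X 0 ^ 3 * X 1 * X 2 ^ 5 + 33 * X 0 ^ 2 * X 2 ^ 7) * h3
  · linear_combination (285 * X 0 ^ 3 * X 1 ^ 2 * X 2 ^ 4 + 231 * X 0 ^ 2 * X 1 * X 2 ^ 6 +
      27 * X 0 * X 2 ^ 8) * h3

end Briancon

namespace Briancon

open PlaneCurve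

theorem isHomogeneous_of_eq {f : S} {m n : ℕ} (hf : f.IsHomogeneous m) (h : m = n) :
    f.IsHomogeneous n := h ▸ hf

section Syzygies

variable {A : Type} [CommRing A]

/-- A Jacobian syzygy of `C_t`, `t = -16 / 9`. -/
def specialSyzygy₁ (x y z : A) : Fin 3 → A :=
  ![92 * x ^ 3 * y + 92 * x ^ 2 * z ^ 2 + 59 * x * z ^ 3,
    -138 * x ^ 2 * y ^ 2 - 208 * x * y * z ^ 2 - 81 * y * z ^ 3 - 70 * z ^ 4,
    12 * x ^ 2 * y * z + 12 * x * z ^ 3 + 9 * z ^ 4]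

/-- A Jacobian syzygy of `C_t`, `t = -16 / 9`. -/
def specialSyzygy₂ (x y z : A) : Fin 3 → A :=
  ![36 * x * z ^ 4 - 92 * x ^ 4 * y - 828 * x ^ 3 * y * z - 92 * x ^ 3 * z ^ 2 -
      7713 * x ^ 2 * y * z ^ 2 - 887 * x ^ 2 * z ^ 3 - 2070 * z ^ 5,
    138 * x ^ 3 * y ^ 2 + 208 * x ^ 2 * y * z ^ 2 + 9747 * x * y ^ 2 * z ^ 2 + 70 * x * z ^ 4 +
      2196 * y * z ^ 4 - 378 * x ^ 2 * y ^ 2 * z - 1287 * x * y * z ^ 3 - 990 * z ^ 5,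
    810 * x ^ 3 * y ^ 2 + 1512 * x ^ 2 * y * z ^ 2 + 297 * x * y * z ^ 3 + 693 * x * z ^ 4 +
      216 * z ^ 5 - 12 * x ^ 3 * y * z - 12 * x ^ 2 * z ^ 3]

/-- The value 7 is -9 - 9t at t = -16/9. The identity also certifies that both vectors are syzygies.
-/
theorem crossProduct_specialSyzygy (x y z : A) :
    crossProduct (specialSyzygy₁ x y z) (specialSyzygy₂ x y z) =
      (-2070 : A) • gradientForm 7 x y z := by
  funext i
  fin_cases i <;>
    simp only [cross_apply, specialSyzygy₁, specialSyzygy₂, gradientForm, Pi.smul_apply,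
      smul_eq_mul, Fin.zero_eta, Fin.mk_one, Fin.reduceFinMk, Matrix.cons_val] <;> ring

/-- A Jacobian syzygy of `C_0`. -/
def zeroSyzygy₁ (x y z : A) : Fin 3 → A :=
  ![174080 * x ^ 4 * y + 174080 * x ^ 3 * z ^ 2 + 7713 * x ^ 2 * y * z ^ 2 + 70560 * x ^ 2 * z ^ 3 +
      5601 * x * z ^ 4 + 2070 * z ^ 5 - 60000 * x ^ 3 * y * z,
    91620 * x ^ 2 * y ^ 2 * z + 31620 * z ^ 5 - 261120 * x ^ 3 * y ^ 2 -
      348160 * x ^ 2 * y * z ^ 2 - 9747 * x * y ^ 2 * z ^ 2 - 7320 * x * y * z ^ 3 -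
      87040 * x * z ^ 4 - 33219 * y * z ^ 4,
    3231 * z ^ 5 - 810 * x ^ 3 * y ^ 2 - 1620 * x ^ 2 * y * z ^ 2 - 297 * x * y * z ^ 3 -
      810 * x * z ^ 4]

/-- A Jacobian syzygy of `C_0`. -/
def zeroSyzygy₂ (x y z : A) : Fin 3 → A :=
  ![891756 * x ^ 3 * y ^ 2 + 6124320 * x ^ 2 * y * z ^ 2 + 571887 * x * y * z ^ 3 + 470520 * z ^ 5 -
      389120 * x ^ 4 * y - 4467840 * x ^ 3 * y * z - 389120 * x ^ 3 * z ^ 2 -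
      4759680 * x ^ 2 * z ^ 3 - 3398988 * x * z ^ 4,
    583680 * x ^ 3 * y ^ 2 + 5991120 * x ^ 2 * y ^ 2 * z + 778240 * x ^ 2 * y * z ^ 2 +
      7806240 * x * y * z ^ 3 + 194560 * x * z ^ 4 + 1523280 * z ^ 5 - 1337634 * x ^ 2 * y ^ 3 -
      10664460 * x * y ^ 2 * z ^ 2 - 785133 * y ^ 2 * z ^ 3 - 1580778 * y * z ^ 4,
    355320 * x ^ 3 * y ^ 2 + 116316 * x ^ 2 * y ^ 2 * z + 710640 * x ^ 2 * y * z ^ 2 +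
      763560 * x * y * z ^ 3 + 355320 * x * z ^ 4 + 87237 * y * z ^ 4 + 168012 * z ^ 5]

/-- A Jacobian syzygy of `C_0`. -/
def zeroSyzygy₃ (x y z : A) : Fin 3 → A :=
  ![298248 * x ^ 4 * y ^ 2 + 245616 * x ^ 3 * y * z ^ 2 + 436407 * x ^ 2 * y * z ^ 3 +
      65790 * z ^ 6 - 52632 * x ^ 2 * z ^ 4 - 19737 * x * z ^ 5,
    -447372 * x ^ 3 * y ^ 3 - 543864 * x ^ 2 * y ^ 2 * z ^ 2 - 572373 * x * y ^ 2 * z ^ 3 -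
      96492 * x * y * z ^ 4 - 151317 * y * z ^ 5,
    13158 * x ^ 3 * y ^ 2 * z + 26316 * x ^ 2 * y * z ^ 3 + 19737 * x * y * z ^ 4 +
      13158 * x * z ^ 5 + 2193 * z ^ 6]

/-- A coefficient of the relation between the syzygies of `C_0`. -/
def zeroRelation₁ (x y z : A) : A :=
  294370776 * x * y + 14222336 * x * z + 63770247 * y * z + 111351768 * z ^ 2

/-- A coefficient of the relation between the syzygies of `C_0`. -/
def zeroRelation₂ (x y z : A) : A :=
  671058 * x * y + 6362624 * x * z - 2311422 * z ^ 2

/-- A coefficient of the relation between the syzygies of `C_0`. -/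
def zeroRelation₃ (x y z : A) : A :=
  13027392 * z - 170941440 * x - 2006451 * y

theorem crossProduct_zeroSyzygy (x y z : A) :
    crossProduct (zeroSyzygy₁ x y z) (zeroSyzygy₂ x y z) =
      (10 * zeroRelation₃ x y z) • gradientForm (-9) x y z := by
  funext i
  fin_cases i <;>
    simp only [cross_apply, zeroSyzygy₁, zeroSyzygy₂, zeroRelation₃, gradientForm, Pi.smul_apply,
      smul_eq_mul, Fin.zero_eta, Fin.mk_one, Fin.reduceFinMk, Matrix.cons_val] <;> ring

theorem zeroRelation (x y z : A) :
    zeroRelation₁ x y z • zeroSyzygy₁ x y z + zeroRelation₂ x y z • zeroSyzygy₂ x y z +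
      zeroRelation₃ x y z • zeroSyzygy₃ x y z = 0 := by
  funext i
  fin_cases i <;>
    simp only [zeroSyzygy₁, zeroSyzygy₂, zeroSyzygy₃, zeroRelation₁, zeroRelation₂, zeroRelation₃,
      Pi.add_apply, Pi.smul_apply, Pi.zero_apply, smul_eq_mul, Fin.zero_eta, Fin.mk_one,
      Fin.reduceFinMk, Matrix.cons_val] <;> ring

/-- With the next identity, a certificate that the two quadratic coefficients have no common zero on
the line `zeroRelation₃` = 0. -/
theorem zeroRelation_y (x y z : A) :
    (91919340 * y + 1865832960 * z - 1170165760 * x) * zeroRelation₁ x y z +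
      (7231083520 * x + 88867048185 * y + 108814506816 * z) * zeroRelation₂ x y z +
      (171790848 * x * z + 530471349 * y ^ 2 + 6365656188 * y * z + 3358496166 * z ^ 2 -
        1986704490 * x * y) * zeroRelation₃ x y z =
      -1064364768672399 * y ^ 3 := by
  simp only [zeroRelation₁, zeroRelation₂, zeroRelation₃]
  ring

theorem zeroRelation_z (x y z : A) :
    (-45 * x) * zeroRelation₁ x y z +
      (19740 * x + 6462 * z) * zeroRelation₂ x y z +
      (731 * x * z) * zeroRelation₃ x y z =
      -14936408964 * z ^ 3 := by
  simp only [zeroRelation₁, zeroRelation₂, zeroRelation₃]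
  ring

/-- A Jacobian syzygy of `C_1`. -/
def oneSyzygy₁ (x y z : A) : Fin 3 → A :=
  ![985000 * x ^ 4 * y + 985000 * x ^ 3 * z ^ 2 + 15426 * x ^ 2 * y * z ^ 2 +
      330750 * x ^ 2 * z ^ 3 + 18141 * x * z ^ 4 + 4140 * z ^ 5 - 187500 * x ^ 3 * y * z,
    284490 * x ^ 2 * y ^ 2 * z + 207240 * z ^ 5 - 1477500 * x ^ 3 * y ^ 2 -
      1970000 * x ^ 2 * y * z ^ 2 - 19494 * x * y ^ 2 * z ^ 2 - 26520 * x * y * z ^ 3 -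
      492500 * x * z ^ 4 - 102159 * y * z ^ 4,
    10431 * z ^ 5 - 1620 * x ^ 3 * y ^ 2 - 3240 * x ^ 2 * y * z ^ 2 - 594 * x * y * z ^ 3 -
      1620 * x * z ^ 4]

/-- A Jacobian syzygy of `C_1`. -/
def oneSyzygy₂ (x y z : A) : Fin 3 → A :=
  ![2878956 * x ^ 3 * y ^ 2 + 30087594 * x ^ 2 * y * z ^ 2 + 1846287 * x * y * z ^ 3 +
      2591820 * z ^ 5 - 4420000 * x ^ 4 * y - 88131000 * x ^ 3 * y * z - 4420000 * x ^ 3 * z ^ 2 -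
      45132000 * x ^ 2 * z ^ 3 - 32993592 * x * z ^ 4,
    6630000 * x ^ 3 * y ^ 2 + 128782620 * x ^ 2 * y ^ 2 * z + 8840000 * x ^ 2 * y * z ^ 2 +
      103278240 * x * y * z ^ 3 + 2210000 * x * z ^ 4 + 17494620 * z ^ 5 - 4318434 * x ^ 2 * y ^ 3 -
      51162516 * x * y ^ 2 * z ^ 2 - 2534733 * y ^ 2 * z ^ 3 - 7812252 * y * z ^ 4,
    1706940 * x ^ 3 * y ^ 2 + 375516 * x ^ 2 * y ^ 2 * z + 3413880 * x ^ 2 * y * z ^ 2 +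
      3609144 * x * y * z ^ 3 + 1706940 * x * z ^ 4 + 281637 * y * z ^ 4 + 917928 * z ^ 5]

/-- A Jacobian syzygy of `C_1`. -/
def oneSyzygy₃ (x y z : A) : Fin 3 → A :=
  ![50000 * x ^ 5 * y + 4092 * x ^ 4 * y ^ 2 + 428000 * x ^ 4 * y * z + 50000 * x ^ 4 * z ^ 2 +
      456500 * x ^ 3 * z ^ 3 + 13020 * x ^ 2 * y * z ^ 3 + 145620 * x ^ 2 * z ^ 4 +
      7041 * x * z ^ 5 + 2790 * z ^ 6 - 83988 * x ^ 3 * y * z ^ 2,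
    125052 * x ^ 2 * y ^ 2 * z ^ 2 + 93690 * z ^ 6 - 75000 * x ^ 4 * y ^ 2 - 6138 * x ^ 3 * y ^ 3 -
      642000 * x ^ 3 * y ^ 2 * z - 100000 * x ^ 3 * y * z ^ 2 - 880000 * x ^ 2 * y * z ^ 3 -
      25000 * x ^ 2 * z ^ 4 - 16740 * x * y ^ 2 * z ^ 3 - 13920 * x * y * z ^ 4 -
      209500 * x * z ^ 5 - 48159 * y * z ^ 5,
    4731 * z ^ 6 - 558 * x ^ 3 * y ^ 2 * z - 1008 * x ^ 2 * y * z ^ 3]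

/-- A coefficient of the relation between the syzygies of `C_1`. -/
def oneRelation₁ (x y z : A) : A :=
  237075000 * x ^ 2 + 19402218 * x * y + 2074666000 * x * z + 8730747 * y * z - 107787570 * z ^ 2

/-- A coefficient of the relation between the syzygies of `C_1`. -/
def oneRelation₂ (x y z : A) : A :=
  225000 * x ^ 2 + 18414 * x * y + 399250 * x * z - 105735 * z ^ 2

/-- A coefficient of the relation between the syzygies of `C_1`. -/
def oneRelation₃ (x y z : A) : A :=
  258167250 * z - 4650487500 * x - 12955302 * y

theorem crossProduct_oneSyzygy (x y z : A) :
    crossProduct (oneSyzygy₁ x y z) (oneSyzygy₂ x y z) =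
      (10 * oneRelation₃ x y z) • gradientForm (-18) x y z := by
  funext i
  fin_cases i <;>
    simp only [cross_apply, oneSyzygy₁, oneSyzygy₂, oneRelation₃, gradientForm, Pi.smul_apply,
      smul_eq_mul, Fin.zero_eta, Fin.mk_one, Fin.reduceFinMk, Matrix.cons_val] <;> ring

theorem oneRelation (x y z : A) :
    oneRelation₁ x y z • oneSyzygy₁ x y z + oneRelation₂ x y z • oneSyzygy₂ x y z +
      oneRelation₃ x y z • oneSyzygy₃ x y z = 0 := by
  funext i
  fin_cases i <;>
    simp only [oneSyzygy₁, oneSyzygy₂, oneSyzygy₃, oneRelation₁, oneRelation₂, oneRelation₃,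
      Pi.add_apply, Pi.smul_apply, Pi.zero_apply, smul_eq_mul, Fin.zero_eta, Fin.mk_one,
      Fin.reduceFinMk, Matrix.cons_val] <;> ring

/-- The corresponding certificate for C₁. -/
theorem oneRelation_y (x y z : A) :
    (150173834475000 * x + 72946785897594 * y + 4411105893558000 * z) * oneRelation₁ x y z +
      (23348825734050000 * x + 217230176104693632 * y +
        431494010216874000 * z) * oneRelation₂ x y z +
      (8785304250000 * x ^ 2 + 14923270597320 * x * y + 315235709590000 * x * z +
        1122908174199 * y ^ 2 + 71536583822634 * y * z +
        2018406302308200 * z ^ 2) * oneRelation₃ x y z =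
      -14547614515016653098 * y ^ 3 := by
  simp only [oneRelation₁, oneRelation₂, oneRelation₃]
  ring

theorem oneRelation_z (x y z : A) :
    (-90 * x) * oneRelation₁ x y z +
      (94830 * x + 20862 * z) * oneRelation₂ x y z +
      (-31 * x * z) * oneRelation₃ x y z =
      -2205843570 * z ^ 3 := by
  simp only [oneRelation₁, oneRelation₂, oneRelation₃]
  ring

end Syzygies

theorem isHomogeneous_specialSyzygy₁ (i : Fin 3) :
    (specialSyzygy₁ (X 0 : S) (X 1) (X 2) i).IsHomogeneous 4 := by
  fin_cases i <;>
    simp only [specialSyzygy₁, Fin.zero_eta, Fin.mk_one, Fin.reduceFinMk, Matrix.cons_val]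
  repeat' with_reducible_and_instances first
    | apply IsHomogeneous.add
    | apply IsHomogeneous.sub
  -- The degree of each monomial is first collected from its factors, and only then compared with
  -- the required one.
  all_goals apply isHomogeneous_of_eq
  repeat' with_reducible_and_instances first
    | exact isHomogeneous_X_pow _ _
    | exact isHomogeneous_X _ _
    | exact isHomogeneous_ofNat
    | exact isHomogeneous_ofNat.neg
    | apply IsHomogeneous.mul
  all_goals rfl

theorem isHomogeneous_specialSyzygy₂ (i : Fin 3) :
    (specialSyzygy₂ (X 0 : S) (X 1) (X 2) i).IsHomogeneous 5 := by
  fin_cases i <;>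
    simp only [specialSyzygy₂, Fin.zero_eta, Fin.mk_one, Fin.reduceFinMk, Matrix.cons_val]
  repeat' with_reducible_and_instances first
    | apply IsHomogeneous.add
    | apply IsHomogeneous.sub
  all_goals apply isHomogeneous_of_eq
  repeat' with_reducible_and_instances first
    | exact isHomogeneous_X_pow _ _
    | exact isHomogeneous_X _ _
    | exact isHomogeneous_ofNat
    | exact isHomogeneous_ofNat.neg
    | apply IsHomogeneous.mul
  all_goals rfl

theorem isHomogeneous_zeroSyzygy₁ (i : Fin 3) :
    (zeroSyzygy₁ (X 0 : S) (X 1) (X 2) i).IsHomogeneous 5 := by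
  fin_cases i <;>
    simp only [zeroSyzygy₁, Fin.zero_eta, Fin.mk_one, Fin.reduceFinMk, Matrix.cons_val]
  repeat' with_reducible_and_instances first
    | apply IsHomogeneous.add
    | apply IsHomogeneous.sub
  all_goals apply isHomogeneous_of_eq
  repeat' with_reducible_and_instances first
    | exact isHomogeneous_X_pow _ _
    | exact isHomogeneous_X _ _
    | exact isHomogeneous_ofNat
    | exact isHomogeneous_ofNat.neg
    | apply IsHomogeneous.mul
  all_goals rfl

theorem isHomogeneous_zeroSyzygy₂ (i : Fin 3) :
    (zeroSyzygy₂ (X 0 : S) (X 1) (X 2) i).IsHomogeneous 5 := by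
  fin_cases i <;>
    simp only [zeroSyzygy₂, Fin.zero_eta, Fin.mk_one, Fin.reduceFinMk, Matrix.cons_val]
  repeat' with_reducible_and_instances first
    | apply IsHomogeneous.add
    | apply IsHomogeneous.sub
  all_goals apply isHomogeneous_of_eq
  repeat' with_reducible_and_instances first
    | exact isHomogeneous_X_pow _ _
    | exact isHomogeneous_X _ _
    | exact isHomogeneous_ofNat
    | exact isHomogeneous_ofNat.neg
    | apply IsHomogeneous.mul
  all_goals rfl

theorem isHomogeneous_zeroSyzygy₃ (i : Fin 3) :
    (zeroSyzygy₃ (X 0 : S) (X 1) (X 2) i).IsHomogeneous 6 := by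
  fin_cases i <;>
    simp only [zeroSyzygy₃, Fin.zero_eta, Fin.mk_one, Fin.reduceFinMk, Matrix.cons_val]
  repeat' with_reducible_and_instances first
    | apply IsHomogeneous.add
    | apply IsHomogeneous.sub
  all_goals apply isHomogeneous_of_eq
  repeat' with_reducible_and_instances first
    | exact isHomogeneous_X_pow _ _
    | exact isHomogeneous_X _ _
    | exact isHomogeneous_ofNat
    | exact isHomogeneous_ofNat.neg
    | apply IsHomogeneous.mul
  all_goals rfl

theorem isHomogeneous_zeroRelation₁ :
    (zeroRelation₁ (X 0 : S) (X 1) (X 2)).IsHomogeneous 2 := by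
  rw [zeroRelation₁]
  repeat' with_reducible_and_instances first
    | apply IsHomogeneous.add
    | apply IsHomogeneous.sub
  all_goals apply isHomogeneous_of_eq
  repeat' with_reducible_and_instances first
    | exact isHomogeneous_X_pow _ _
    | exact isHomogeneous_X _ _
    | exact isHomogeneous_ofNat
    | exact isHomogeneous_ofNat.neg
    | apply IsHomogeneous.mul
  all_goals rfl

theorem isHomogeneous_zeroRelation₂ :
    (zeroRelation₂ (X 0 : S) (X 1) (X 2)).IsHomogeneous 2 := by
  rw [zeroRelation₂]
  repeat' with_reducible_and_instances first
    | apply IsHomogeneous.add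
    | apply IsHomogeneous.sub
  all_goals apply isHomogeneous_of_eq
  repeat' with_reducible_and_instances first
    | exact isHomogeneous_X_pow _ _
    | exact isHomogeneous_X _ _
    | exact isHomogeneous_ofNat
    | exact isHomogeneous_ofNat.neg
    | apply IsHomogeneous.mul
  all_goals rfl

theorem isHomogeneous_oneSyzygy₁ (i : Fin 3) :
    (oneSyzygy₁ (X 0 : S) (X 1) (X 2) i).IsHomogeneous 5 := by
  fin_cases i <;>
    simp only [oneSyzygy₁, Fin.zero_eta, Fin.mk_one, Fin.reduceFinMk, Matrix.cons_val]
  repeat' with_reducible_and_instances first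
    | apply IsHomogeneous.add
    | apply IsHomogeneous.sub
  all_goals apply isHomogeneous_of_eq
  repeat' with_reducible_and_instances first
    | exact isHomogeneous_X_pow _ _
    | exact isHomogeneous_X _ _
    | exact isHomogeneous_ofNat
    | exact isHomogeneous_ofNat.neg
    | apply IsHomogeneous.mul
  all_goals rfl

theorem isHomogeneous_oneSyzygy₂ (i : Fin 3) :
    (oneSyzygy₂ (X 0 : S) (X 1) (X 2) i).IsHomogeneous 5 := by
  fin_cases i <;>
    simp only [oneSyzygy₂, Fin.zero_eta, Fin.mk_one, Fin.reduceFinMk, Matrix.cons_val]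
  repeat' with_reducible_and_instances first
    | apply IsHomogeneous.add
    | apply IsHomogeneous.sub
  all_goals apply isHomogeneous_of_eq
  repeat' with_reducible_and_instances first
    | exact isHomogeneous_X_pow _ _
    | exact isHomogeneous_X _ _
    | exact isHomogeneous_ofNat
    | exact isHomogeneous_ofNat.neg
    | apply IsHomogeneous.mul
  all_goals rfl

theorem isHomogeneous_oneSyzygy₃ (i : Fin 3) :
    (oneSyzygy₃ (X 0 : S) (X 1) (X 2) i).IsHomogeneous 6 := by
  fin_cases i <;>
    simp only [oneSyzygy₃, Fin.zero_eta, Fin.mk_one, Fin.reduceFinMk, Matrix.cons_val]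
  repeat' with_reducible_and_instances first
    | apply IsHomogeneous.add
    | apply IsHomogeneous.sub
  all_goals apply isHomogeneous_of_eq
  repeat' with_reducible_and_instances first
    | exact isHomogeneous_X_pow _ _
    | exact isHomogeneous_X _ _
    | exact isHomogeneous_ofNat
    | exact isHomogeneous_ofNat.neg
    | apply IsHomogeneous.mul
  all_goals rfl

theorem isHomogeneous_oneRelation₁ :
    (oneRelation₁ (X 0 : S) (X 1) (X 2)).IsHomogeneous 2 := by
  rw [oneRelation₁]
  repeat' with_reducible_and_instances first
    | apply IsHomogeneous.add
    | apply IsHomogeneous.sub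
  all_goals apply isHomogeneous_of_eq
  repeat' with_reducible_and_instances first
    | exact isHomogeneous_X_pow _ _
    | exact isHomogeneous_X _ _
    | exact isHomogeneous_ofNat
    | exact isHomogeneous_ofNat.neg
    | apply IsHomogeneous.mul
  all_goals rfl

theorem isHomogeneous_oneRelation₂ :
    (oneRelation₂ (X 0 : S) (X 1) (X 2)).IsHomogeneous 2 := by
  rw [oneRelation₂]
  repeat' with_reducible_and_instances first
    | apply IsHomogeneous.add
    | apply IsHomogeneous.sub
  all_goals apply isHomogeneous_of_eq
  repeat' with_reducible_and_instances first
    | exact isHomogeneous_X_pow _ _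
    | exact isHomogeneous_X _ _
    | exact isHomogeneous_ofNat
    | exact isHomogeneous_ofNat.neg
    | apply IsHomogeneous.mul
  all_goals rfl

/-! ### Exponents and Tjurina numbers of the three curves -/

theorem isFree_curve_special : IsFreeWithExponents (curve (-16 / 9)) 4 5 ∧
    HasTotalTjurinaNumber (curve (-16 / 9)) 61 := by
  have hcross : crossProduct (specialSyzygy₁ (X 0 : S) (X 1) (X 2))
      (specialSyzygy₂ (X 0) (X 1) (X 2)) = (C (-18630) : S) • PlaneCurve.gradient (curve (-16 / 9)) := by
    have h : (C (-9 - 9 * (-16 / 9)) : S) = 7 := by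
      rw [← map_ofNat C 7]; norm_num
    have h' : (C (-18630) : S) = -2070 * 9 := by
      simp only [C_neg, map_ofNat]
      norm_num
    rw [crossProduct_specialSyzygy, ← h, ← nine_smul_gradient_curve, smul_smul, h']
  obtain ⟨h1, h2, h3⟩ := isFreeWithExponents_of_cross_eq (isHomogeneous_curve _) (by norm_num)
    (irreducible_curve _) (by norm_num) isHomogeneous_specialSyzygy₁ isHomogeneous_specialSyzygy₂
    (by norm_num) hcross
  refine ⟨h3, hasTotalTjurinaNumber_of_free (isHomogeneous_curve _) (fun j i => ?_) h1 h2⟩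
  fin_cases j
  exacts [isHomogeneous_specialSyzygy₁ i, isHomogeneous_specialSyzygy₂ i]

theorem isMPOG_curve_zero : IsMPOGWithExponents (curve 0) 5 5 6 ∧
    HasTotalTjurinaNumber (curve 0) 59 := by
  have hcross : crossProduct (zeroSyzygy₁ (X 0 : S) (X 1) (X 2)) (zeroSyzygy₂ (X 0) (X 1) (X 2)) =
      (C 90 * zeroRelation₃ (X 0) (X 1) (X 2) : S) • PlaneCurve.gradient (curve 0) := by
    have h : (C (-9 - 9 * 0) : S) = -9 := by
      rw [← map_ofNat C 9, ← C_neg]; norm_num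
    rw [crossProduct_zeroSyzygy, ← h, ← nine_smul_gradient_curve, smul_smul, map_ofNat]
    congr 1
    ring
  refine isMPOG_of_cross_eq (isHomogeneous_curve _) (irreducible_curve _)
    isHomogeneous_zeroSyzygy₁ isHomogeneous_zeroSyzygy₂ isHomogeneous_zeroSyzygy₃
    isHomogeneous_zeroRelation₁ isHomogeneous_zeroRelation₂ (α := -170941440) (β := -2006451)
    (γ := 13027392) (by norm_num) ?_ (by norm_num) hcross (zeroRelation _ _ _)
    -- The point (-β, α, 0) where the line l = 0 meets z = 0 serves both nonvanishing conditions.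
    (P := ![2006451, -170941440, 0]) ?_ ?_ (Q := ![2006451, -170941440, 0]) ?_ (i₀ := 0) ?_
    (m := 3) (n := 3) (a := -1064364768672399) (b := -14936408964) (by norm_num) (by norm_num)
    (Submodule.mem_span_triple.2 ⟨_, _, _, (zeroRelation_y _ _ _).trans ?_⟩)
    (Submodule.mem_span_triple.2 ⟨_, _, _, (zeroRelation_z _ _ _).trans ?_⟩)
  · simp only [zeroRelation₃, C_neg, map_ofNat]
    ring
  · simp [zeroRelation₃]
    norm_num
  · simp [zeroRelation₁]
  · simp [zeroRelation₃]
    norm_num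
  · simp [zeroSyzygy₁]
  · simp only [C_neg, map_ofNat]
  · simp only [C_neg, map_ofNat]

theorem isMPOG_curve_one : IsMPOGWithExponents (curve 1) 5 5 6 ∧
    HasTotalTjurinaNumber (curve 1) 59 := by
  have hcross : crossProduct (oneSyzygy₁ (X 0 : S) (X 1) (X 2)) (oneSyzygy₂ (X 0) (X 1) (X 2)) =
      (C 90 * oneRelation₃ (X 0) (X 1) (X 2) : S) • PlaneCurve.gradient (curve 1) := by
    have h : (C (-9 - 9 * 1) : S) = -18 := by
      rw [← map_ofNat C 18, ← C_neg]; norm_num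
    rw [crossProduct_oneSyzygy, ← h, ← nine_smul_gradient_curve, smul_smul, map_ofNat]
    congr 1
    ring
  refine isMPOG_of_cross_eq (isHomogeneous_curve _) (irreducible_curve _)
    isHomogeneous_oneSyzygy₁ isHomogeneous_oneSyzygy₂ isHomogeneous_oneSyzygy₃
    isHomogeneous_oneRelation₁ isHomogeneous_oneRelation₂ (α := -4650487500) (β := -12955302)
    (γ := 258167250) (by norm_num) ?_ (by norm_num) hcross (oneRelation _ _ _)
    -- Again the point (-β, α, 0) of the line l = 0.
    (P := ![12955302, -4650487500, 0]) ?_ ?_ (Q := ![12955302, -4650487500, 0]) ?_ (i₀ := 0) ?_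
    (m := 3) (n := 3) (a := -14547614515016653098) (b := -2205843570) (by norm_num) (by norm_num)
    (Submodule.mem_span_triple.2 ⟨_, _, _, (oneRelation_y _ _ _).trans ?_⟩)
    (Submodule.mem_span_triple.2 ⟨_, _, _, (oneRelation_z _ _ _).trans ?_⟩)
  · simp only [oneRelation₃, C_neg, map_ofNat]
    ring
  · simp [oneRelation₃]
    norm_num
  · simp [oneRelation₁]
    norm_num
  · simp [oneRelation₃]
    norm_num
  · simp [oneSyzygy₁]
  · simp only [C_neg, map_ofNat]
  · simp only [C_neg, map_ofNat]

end Briancon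

theorem proposition3p3 :
    (∀ t ∈ ({0, -16 / 9, 1} : Set ℂ), PlaneCurve.IsReducedCurve (Briancon.curve t) 10) ∧
    PlaneCurve.HasGeometricGenus (Briancon.curve 1) 1 ∧
    PlaneCurve.HasGeometricGenus (Briancon.curve 0) 0 ∧
    PlaneCurve.HasGeometricGenus (Briancon.curve (-16 / 9)) 0 ∧
    PlaneCurve.IsMPOGWithExponents (Briancon.curve 0) 5 5 6 ∧
    PlaneCurve.HasTotalTjurinaNumber (Briancon.curve 0) 59 ∧
    PlaneCurve.IsMPOGWithExponents (Briancon.curve 1) 5 5 6 ∧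
    PlaneCurve.HasTotalTjurinaNumber (Briancon.curve 1) 59 ∧
    PlaneCurve.IsFreeWithExponents (Briancon.curve (-16 / 9)) 4 5 ∧
    PlaneCurve.HasTotalTjurinaNumber (Briancon.curve (-16 / 9)) 61 :=
  ⟨fun t _ => Briancon.isReducedCurve_curve t, Briancon.hasGeometricGenus_one,
    Briancon.hasGeometricGenus_zero, Briancon.hasGeometricGenus_special,
    Briancon.isMPOG_curve_zero.1, Briancon.isMPOG_curve_zero.2,
    Briancon.isMPOG_curve_one.1, Briancon.isMPOG_curve_one.2,
    Briancon.isFree_curve_special.1, Briancon.isFree_curve_special.2⟩
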